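/- \textbf{Setting.} Consider a finite sequential game with players $1,\dots,N$, a chance player with fixed action probabilities, and a finite non-empty action set $A$. Histories are finite sequences of actions, starting from the empty history $h_{\rm init}$; at each non-terminal history $h$ either chance moves or a player $i$ moves, who only observes the information state $x(h)\in\mathcal X_i$ (the sets $\mathcal X_i$ are finite and disjoint, $\mathcal X=\bigcup_i\mathcal X_i$). The game has perfect recall: two histories in the same information state of player $i$ contain the same sequence of earlier information states and actions of player $i$. When $a$ is played at $h$, player $i$ receives $r^i(h,a)\in\mathbb R$, which does not depend on the policy. A policy is $\pi=(\pi(\cdot|x))_{x\in\mathcal X}$ with $\pi(\cdot|x)\in\Delta A$; $V^i_\pi(h)$ is player $i$'s expected future reward from $h$, $Q^i_\pi(h,a)=r^i(h,a)+V^i_\pi(ha)$, and $\rho^{\pi^{-i}}(h)$ is the product of the probabilities of all actions on the way to $h$ that were not chosen by $i$. For $x\in\mathcal X_i$, sums being over non-terminal histories $h$ with $x(h)=x$, let $\rho^{\pi^{-i}}(x)=\sum_{h\in x}\rho^{\pi^{-i}}(h)$ and $Q^i_\pi(x,a)=\rho^{\pi^{-i}}(x)^{-1}\sum_{h\in x}\rho^{\pi^{-i}}(h)Q^i_\pi(h,a)$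 (the product $\rho^{\pi^{-i}}(x)Q^i_\pi(x,a)$ being $0$ if $\rho^{\pi^{-i}}(x)=0$). Write $V^i_\pi=V^i_\pi(h_{\rm init})$. The game is monotone: for all policies $\pi\ne\mu$, $$\sum_{i=1}^N\big(V^i_{\pi^i,\pi^{-i}}-V^i_{\mu^i,\pi^{-i}}-V^i_{\pi^i,\mu^{-i}}+V^i_{\mu^i,\mu^{-i}}\big)\le 0 .$$ Let $\pi^*$ be a Nash equilibrium of full support: $V^i_{\mu^i,\pi^{*-i}}\le V^i_{\pi^*}$ for all $i,\mu$, and $\pi^*(a|x)>0$ for all $x,a$. For each player let $\phi_i$ be a regularizer on $\Delta A$: continuous and strictly convex on $\Delta A$, and smooth on the relative interior of every face of $\Delta A$. Scores $y\in\mathbb R^{\mathcal X\times A}$ generate the policy $\pi_y$, $\pi_y(\cdot|x)=\arg\max_{p\in\Delta A}\big(\langle y(x,\cdot),p\rangle-\phi_i(p)\big)$ for $x\in\mathcal X_i$. A \emph{FoReL trajectory} with starting scores $y_0$ is a solution on $[0,\infty)$ of $$\dot y_t(x,a)=\rho^{\pi_t^{-i}}(x)\,Q^i_{\pi_t}(x,a),\qquad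 \pi_t=\pi_{y_t}\qquad(x\in\mathcal X_i,\ a\in A).$$ Fix an action $a_x$ for every $x$, and for scores $y$ put $\bar y(x,a)=y(x,a)-y(x,a_x)$. The \emph{reduced FoReL dynamics} $\dot w_t=\xi(w_t)$ on $\mathbb R^{\mathcal X\times A}$ is $$\dot w_t(x,a)=\rho^{\pi_t^{-i}}(x)\big[Q^i_{\pi_t}(x,a)-Q^i_{\pi_t}(x,a_x)\big],\qquad \pi_t=\pi_{w_t}.$$ Call a path $w:[0,\infty)\to E$ \emph{recurrent} if $w_{t_n}\to w_0$ for some sequence $t_n\to\infty$. \textbf{Theorem.} \begin{enumerate} \item The reduced dynamics is divergence-free: at every $w$, all partial derivatives $\partial\xi(w)(x,a)/\partial w(x,a)$ exist and their sum over all $(x,a)$ is $0$. \item The reduced dynamics has a solution on $[0,\infty)$ from every starting point, and every solution on $[0,\infty)$ is bounded. \item The reduced dynamics is equivalent to FoReL: $\pi_{\bar y}=\pi_y$ for all scores $y$; if $y_t$ is a FoReL trajectory, then $\bar y_t$ solves the reduced dynamics; and if $w_t$ solves the reduced dynamics and $w_0=\bar y_0$, then there is a FoReL trajectory $y_t$ with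 starting scores $y_0$ and $\bar y_t=w_t$ for all $t\ge 0$. \item Poincaré recurrence: from Lebesgue-almost every $w_0$ there is a recurrent solution of the reduced dynamics, and from Lebesgue-almost every $y_0$ there is a FoReL trajectory for which both $\bar y_t$ and the policy $\pi_{y_t}$ are recurrent. If any two FoReL trajectories with the same starting scores coincide, then from almost every $w_0$ every solution of the reduced dynamics is recurrent, and from almost every $y_0$ every FoReL trajectory has $\bar y_t$ and $\pi_{y_t}$ recurrent. Any two FoReL trajectories with the same starting scores do coincide if every $\phi_i$ is strongly convex on $\Delta A$. \item Every FoReL trajectory with $\pi_{y_0}\neq\pi^*$ does not converge to the equilibrium: $\pi_{y_t}\not\to\pi^*$ as $t\to\infty$. \end{enumerate} -/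

import Mathlib

open Filter Topology MeasureTheory
open scoped ContDiff

/-- A finite sequential imperfect-information game with `N` players and a chance player, with
action set `A` and with players' information states `X`. A history is the list of the actions
played so far, the MOST RECENT ACTION FIRST: the initial history is `[]`, and the history `ha`
(action `a` played at `h`) is `a :: h`. The reward depends on the history and the action only,
i.e. it is policy-independent. -/
structure SeqGame (N : ℕ) (A X : Type*) [Fintype A] where
  /-- the finite set of non-terminal histories -/
  nonterminal : Finset (List A)
  /-- a history can be continued only from a non-terminal one -/
  prefix_mem : ∀ (h : List A) (a : A), a :: h ∈ nonterminal → h ∈ nonterminal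
  /-- the information state observed by the player to move; `none` if chance moves -/
  info : List A → Option X
  /-- the player who owns an information state -/
  player : X → Fin N
  /-- the fixed action probabilities of the chance player -/
  chance : List A → A → ℝ
  chance_nonneg : ∀ h ∈ nonterminal, info h = none → ∀ a, 0 ≤ chance h a
  chance_sum : ∀ h ∈ nonterminal, info h = none → ∑ a, chance h a = 1
  /-- the reward received by each player when an action is played at a history -/
  reward : Fin N → List A → A → ℝ

/-- A regularizer on the simplex `ΔA`: continuous and strictly convex on `ΔA`, and smooth on the
relative interior of every face of `ΔA`. The faces are indexed by the supports `S ⊆ A`. -/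
structure Regularizer (A : Type*) [Fintype A] where
  toFun : (A → ℝ) → ℝ
  continuousOn : ContinuousOn toFun (stdSimplex ℝ A)
  strictConvexOn : StrictConvexOn ℝ (stdSimplex ℝ A) toFun
  smooth : ∀ S : Set A, ContDiffOn ℝ ∞ toFun {p ∈ stdSimplex ℝ A | ∀ a, 0 < p a ↔ a ∈ S}

namespace Regularizer

variable {A : Type*} [Fintype A]

/-- `Λ(p, y) = ⟨y, p⟩ - φ(p)`. -/
noncomputable def objective (φ : Regularizer A) (y p : A → ℝ) : ℝ :=
  ∑ a, y a * p a - φ.toFun p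

theorem exists_argmax [Nonempty A] (φ : Regularizer A) (y : A → ℝ) :
    ∃ p : stdSimplex ℝ A, ∀ q : stdSimplex ℝ A, φ.objective y q ≤ φ.objective y p := by
  classical
  have hne : (stdSimplex ℝ A).Nonempty :=
    ⟨_, single_mem_stdSimplex ℝ (Classical.arbitrary A)⟩
  have hc : ContinuousOn (φ.objective y) (stdSimplex ℝ A) := by
    unfold objective
    exact (Continuous.continuousOn (by fun_prop)).sub φ.continuousOn
  obtain ⟨p, hp, hmax⟩ := (isCompact_stdSimplex ℝ A).exists_isMaxOn hne hc
  exact ⟨⟨p, hp⟩, fun q => hmax q.2⟩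

/-- `argmax_{p ∈ ΔA} Λ(p, y)`. -/
noncomputable def choice [Nonempty A] (φ : Regularizer A) (y : A → ℝ) : stdSimplex ℝ A :=
  (φ.exists_argmax y).choose

theorem choice_spec [Nonempty A] (φ : Regularizer A) (y : A → ℝ) (q : stdSimplex ℝ A) :
    φ.objective y q ≤ φ.objective y (φ.choice y) :=
  (φ.exists_argmax y).choose_spec q

/-- The maximizer is unique, so `choice` really is the argmax. -/
theorem eq_choice [Nonempty A] (φ : Regularizer A) (y : A → ℝ) (p : stdSimplex ℝ A)
    (hp : ∀ q : stdSimplex ℝ A, φ.objective y q ≤ φ.objective y p) : p = φ.choice y := by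
  have hlin : ConcaveOn ℝ (stdSimplex ℝ A) (fun p : A → ℝ => ∑ a, y a * p a) := by
    refine ⟨convex_stdSimplex ℝ A, fun p _ q _ s t _ _ _ => le_of_eq ?_⟩
    simp only [smul_eq_mul, Pi.add_apply, Pi.smul_apply, Finset.mul_sum]
    rw [← Finset.sum_add_distrib]
    exact Finset.sum_congr rfl fun a _ => by ring
  have hs : StrictConcaveOn ℝ (stdSimplex ℝ A) (φ.objective y) := by
    have := hlin.add_strictConcaveOn φ.strictConvexOn.neg
    refine this.congr fun p _ => ?_
    simp [objective, sub_eq_add_neg]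
  exact Subtype.ext (hs.eq_of_isMaxOn (fun q hq => hp ⟨q, hq⟩)
    (fun q hq => φ.choice_spec y ⟨q, hq⟩) p.2 (φ.choice y).2)

end Regularizer

namespace SeqGame

variable {N : ℕ} {A X : Type*} [Fintype A]

/-- A (joint) policy: a distribution over actions at every players' information state. -/
abbrev Policy (_G : SeqGame N A X) : Type _ := X → stdSimplex ℝ A

/-- The player to move at a history (`none` for chance). -/
def turn (G : SeqGame N A X) (h : List A) : Option (Fin N) := (G.info h).map G.player

/-- The probability that `a` is played at `h`. -/
def act (G : SeqGame N A X) (π : G.Policy) (h : List A) (a : A) : ℝ :=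
  match G.info h with
  | none => G.chance h a
  | some x => (π x : A → ℝ) a

/-- The joint policy `(μⁱ, π⁻ⁱ)`. -/
def deviate (G : SeqGame N A X) (i : Fin N) (μ π : G.Policy) : G.Policy :=
  fun x => if G.player x = i then μ x else π x

/-- A bound on the length of the histories, used only for the termination of `value`. -/
def depth (G : SeqGame N A X) : ℕ := G.nonterminal.sup fun h => h.length + 1

theorem length_lt_depth (G : SeqGame N A X) {h : List A} (hh : h ∈ G.nonterminal) :
    h.length < G.depth :=
  Finset.le_sup (f := fun h : List A => h.length + 1) hh

open Classical in
/-- The value `Vⁱ_π(h)`. It vanishes at terminal histories. -/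
noncomputable def value (G : SeqGame N A X) (π : G.Policy) (i : Fin N) (h : List A) : ℝ :=
  if _hh : h ∈ G.nonterminal then
    ∑ a, G.act π h a * (G.reward i h a + value G π i (a :: h))
  else 0
termination_by G.depth - h.length
decreasing_by
  have := G.length_lt_depth _hh
  simp only [List.length_cons]
  omega

/-- `Qⁱ_π(h, a)`. -/
noncomputable def qHist (G : SeqGame N A X) (π : G.Policy) (i : Fin N) (h : List A) (a : A) : ℝ :=
  G.reward i h a + G.value π i (a :: h)

/-- The reach probability `ρ^{π⁻ⁱ}(h)` of everybody but player `i` (chance included). -/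
def oppReach (G : SeqGame N A X) (π : G.Policy) (i : Fin N) : List A → ℝ
  | [] => 1
  | a :: h => G.oppReach π i h * (if G.turn h = some i then 1 else G.act π h a)

open Classical in
/-- The non-terminal histories in the information state `x`. -/
noncomputable def infoSet (G : SeqGame N A X) (x : X) : Finset (List A) :=
  G.nonterminal.filter fun h => G.info h = some x

/-- `ρ^{π⁻ⁱ}(x)`, where `i` is the owner of `x`. -/
noncomputable def oppReachInfo (G : SeqGame N A X) (π : G.Policy) (x : X) : ℝ :=
  ∑ h ∈ G.infoSet x, G.oppReach π (G.player x) h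

/-- `Qⁱ_π(x, a)`, where `i` is the owner of `x`. (If `ρ^{π⁻ⁱ}(x) = 0` this is `0`; it is only used
multiplied by `ρ^{π⁻ⁱ}(x)`, and the product is always the numerator.) -/
noncomputable def qInfo (G : SeqGame N A X) (π : G.Policy) (x : X) (a : A) : ℝ :=
  (∑ h ∈ G.infoSet x, G.oppReach π (G.player x) h * G.qHist π (G.player x) h a) /
    ∑ h ∈ G.infoSet x, G.oppReach π (G.player x) h

/-- The information states of player `i` passed on the way to a history, each with the action
that `i` played there (most recent first). -/
def ownSequence (G : SeqGame N A X) (i : Fin N) : List A → List (X × A)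
  | [] => []
  | a :: h =>
    match G.info h with
    | none => G.ownSequence i h
    | some x => if G.player x = i then (x, a) :: G.ownSequence i h else G.ownSequence i h

/-- Perfect recall: two histories in the same information state have the same past information
states and actions of the owner. -/
def PerfectRecall (G : SeqGame N A X) : Prop :=
  ∀ x, ∀ h ∈ G.infoSet x, ∀ h' ∈ G.infoSet x,
    G.ownSequence (G.player x) h = G.ownSequence (G.player x) h'

/-- `Ωⁱ(π, μ)`. -/
noncomputable def omega (G : SeqGame N A X) (i : Fin N) (π μ : G.Policy) : ℝ :=
  G.value π i [] - G.value (G.deviate i μ π) i [] - G.value (G.deviate i π μ) i []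
    + G.value μ i []

/-- Monotone games. -/
def IsMonotone (G : SeqGame N A X) : Prop :=
  ∀ π μ : G.Policy, π ≠ μ → ∑ i, G.omega i π μ ≤ 0

/-- Nash equilibria. -/
def IsNash (G : SeqGame N A X) (π : G.Policy) : Prop :=
  ∀ (i : Fin N) (μ : G.Policy), G.value (G.deviate i μ π) i [] ≤ G.value π i []

/-- Interior (full-support) policies. -/
def IsInterior (G : SeqGame N A X) (π : G.Policy) : Prop :=
  ∀ x a, 0 < (π x : A → ℝ) a

variable [Nonempty A]

/-- The policy generated by the scores `y`: `πⁱ(·|x) = argmax_{p ∈ ΔA} Λⁱ(p, yⁱ(x, ·))`. -/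
noncomputable def policyOf (G : SeqGame N A X) (φ : Fin N → Regularizer A) (y : X → A → ℝ) :
    G.Policy :=
  fun x => (φ (G.player x)).choice (y x)

/-- `y : [0, ∞) → ℝ^{X × A}` follows FoReL:
`ẏⁱ(x, a) = ρ^{π⁻ⁱ}(x) Qⁱ_π(x, a)` with `π` generated by `y`. -/
def IsFoReL (G : SeqGame N A X) [Fintype X] (φ : Fin N → Regularizer A) (y : ℝ → X → A → ℝ) :
    Prop :=
  ∀ t, 0 ≤ t → HasDerivWithinAt y
    (fun x a => G.oppReachInfo (G.policyOf φ (y t)) x * G.qInfo (G.policyOf φ (y t)) x a)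
    (Set.Ici 0) t

/-- The vector field `ξ` of the reduced dynamics, with reference actions `a₀ x`:
`ξ(w)(x, a) = ρ^{π⁻ⁱ}(x) [Qⁱ_π(x, a) - Qⁱ_π(x, a₀ x)]` with `π` generated by `w`. -/
noncomputable def reducedField (G : SeqGame N A X) (φ : Fin N → Regularizer A) (a₀ : X → A)
    (w : X → A → ℝ) : X → A → ℝ :=
  fun x a => G.oppReachInfo (G.policyOf φ w) x *
    (G.qInfo (G.policyOf φ w) x a - G.qInfo (G.policyOf φ w) x (a₀ x))

/-- `w : [0, ∞) → ℝ^{X × A}` solves the reduced dynamics `ẇ = ξ(w)`. -/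
def IsReduced (G : SeqGame N A X) [Fintype X] (φ : Fin N → Regularizer A) (a₀ : X → A)
    (w : ℝ → X → A → ℝ) : Prop :=
  ∀ t, 0 ≤ t → HasDerivWithinAt w (G.reducedField φ a₀ (w t)) (Set.Ici 0) t

end SeqGame

/-- The scores relative to the reference actions: `y(x, a) - y(x, a₀ x)`. -/
def reduceScores {A X : Type*} (a₀ : X → A) (y : X → A → ℝ) : X → A → ℝ :=
  fun x a => y x a - y x (a₀ x)

open Classical in
/-- A vector field on `ℝ^{X × A}` is divergence-free: at every point the diagonal partial
derivatives `∂F(x, a)/∂w(x, a)` exist and their sum is `0`. -/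
def DivergenceFree {A X : Type*} [Fintype A] [Fintype X]
    (F : (X → A → ℝ) → (X → A → ℝ)) : Prop :=
  ∀ w : X → A → ℝ,
    (∀ x a, DifferentiableAt ℝ
      (fun s : ℝ => F (Function.update w x (Function.update (w x) a s)) x a) (w x a)) ∧
    ∑ x, ∑ a,
      deriv (fun s : ℝ => F (Function.update w x (Function.update (w x) a s)) x a) (w x a) = 0

/-- A path returns arbitrarily close to its starting point at arbitrarily large times. -/
def IsRecurrent {E : Type*} [TopologicalSpace E] (w : ℝ → E) : Prop :=
  ∃ t : ℕ → ℝ, Tendsto t atTop atTop ∧ Tendsto (fun n => w (t n)) atTop (𝓝 (w 0))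

/-!
The block `ξ(w)(x, ·)` of the reduced field is a difference of counterfactual values at `x`. With
perfect recall no information state is visited twice, so these do not depend on the policy at `x`,
hence not on `w(x, ·)` (`SeqGame.counterfactualValue_congr`). The field is therefore divergence-free
in a very strong sense: an Euler step for a single block is a shear, which preserves volume exactly,
although `ξ` need not be more than continuous (`measurePreserving_blockStep`).

*Boundedness.* The Lyapunov function is a sum over the information states of the Fenchel couplings
of the scores with the equilibrium `π*`, weighted by the owner's probability under `π*` of playing
to that state. The choice map is the gradient of the conjugate of the regularizer
(`Regularizer.hasFDerivAt_coupling`), so by the performance difference formula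
(`SeqGame.sum_value_deviate_sub_value`) the Lyapunov function decreases at the rate
`∑ᵢ (Vⁱ(π*ⁱ, π⁻ⁱ) - Vⁱ(π))`, which is nonnegative for a monotone game and a Nash equilibrium
(`SeqGame.totalGain_nonneg`). Since `π*` has full support, the Lyapunov function controls all score
differences, while the scores of the reference actions are constants of motion; so the orbits stay
in compact sets.

*Existence and recurrence.* Solutions need not be unique, so there is no flow to which Poincaré's
theorem could be applied. Instead, updating the blocks one after the other gives a
volume-preserving scheme whose discrete orbits converge, along ultrafilters, to solutions
(`IsScheme.exists_isSolution`). Start the discrete orbits from the uniform distribution on a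
sublevel set of the Lyapunov function. Their laws on sequence space have a weak limit by Prokhorov's
theorem; it is carried by solutions sampled at integer times, and it is invariant under the shift
because the scheme preserves volume and nearly preserves the sublevel set
(`IsScheme.exists_shift_invariant_law`). Poincaré recurrence for the shift then yields a recurrent
solution from almost every starting point (`IsScheme.ae_exists_recurrent`).

*Non-convergence.* Along a recurrent solution the decreasing Lyapunov function is constant. Its rate
of decrease is a continuous function of the scores, and it vanishes almost everywhere, hence
everywhere (`SeqGame.totalGain_policyOf_eq_zero`). So the Lyapunov function is conserved along every
trajectory; it is zero exactly when the scores generate `π*`.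
-/

/-! ### Solutions of differential equations as limits of one-step schemes -/

section Schemes

variable {E : Type*} [NormedAddCommGroup E] [NormedSpace ℝ E]

/-- `u` solves the autonomous equation `u' = ξ(u)` on `[0, ∞)`. -/
def IsSolution (ξ : E → E) (u : ℝ → E) : Prop :=
  ∀ t, 0 ≤ t → HasDerivWithinAt u (ξ (u t)) (Set.Ici 0) t

/-- The maps `T n` form a consistent one-step scheme for the equation `u' = ξ(u)`, with time step
`1 / (n + 1)`: one step moves no point by more than `C / (n + 1)`, and near `w₀` its increment is
`ξ(w₀) / (n + 1)` up to an error that is small relative to the time step. -/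
structure IsScheme (ξ : E → E) (C : ℝ) (T : ℕ → E → E) : Prop where
  norm_sub_le : ∀ n w, ‖T n w - w‖ ≤ C / (n + 1)
  consistent : ∀ w₀, ∀ ε > 0, ∃ δ > 0, ∀ᶠ n : ℕ in atTop, ∀ w, ‖w - w₀‖ < δ →
    ‖T n w - w - (1 / (n + 1 : ℝ)) • ξ w₀‖ ≤ ε / (n + 1)

theorem norm_sub_sub_smul_le_of_increments (z : ℕ → E) (v : E) (h r : ℝ) {a b : ℕ} (hab : a ≤ b)
    (hz : ∀ k, a ≤ k → k < b → ‖z (k + 1) - z k - h • v‖ ≤ r) :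
    ‖z b - z a - (((b : ℝ) - a) * h) • v‖ ≤ ((b : ℝ) - a) * r := by
  induction b, hab using Nat.le_induction with
  | base => simp
  | succ b hab ih =>
    have h1 := ih fun k hk hk' => hz k hk (by omega)
    have h2 := hz b hab (by omega)
    have h3 : z (b + 1) - z a - ((((b + 1 : ℕ) : ℝ) - a) * h) • v
        = (z b - z a - (((b : ℝ) - a) * h) • v) + (z (b + 1) - z b - h • v) := by
      push_cast
      module
    rw [h3]
    refine (norm_add_le _ _).trans ?_
    push_cast
    linarith

namespace IsScheme

variable {ξ : E → E} {C : ℝ} {T : ℕ → E → E}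

theorem norm_iterate_sub_le (hT : IsScheme ξ C T) (n : ℕ) (w : E) {a b : ℕ} (hab : a ≤ b) :
    ‖(T n)^[b] w - (T n)^[a] w‖ ≤ ((b : ℝ) - a) * (C / (n + 1)) := by
  have := norm_sub_sub_smul_le_of_increments (fun k => (T n)^[k] w) 0 0 (C / (n + 1)) hab
    fun k _ _ => by
      simpa [Function.iterate_succ_apply'] using hT.norm_sub_le n ((T n)^[k] w)
  simpa using this

theorem tendsto_floor_div {t : ℝ} (ht : 0 ≤ t) :
    Tendsto (fun n : ℕ => (⌊t * (n + 1)⌋₊ : ℝ) / (n + 1)) atTop (𝓝 t) := by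
  have h := (tendsto_nat_floor_mul_div_atTop ht).comp
    (tendsto_atTop_add_const_right atTop (1 : ℝ) tendsto_natCast_atTop_atTop)
  exact h

/-- **Peano's theorem**, by a compactness argument along an ultrafilter: the pointwise limit of the
discrete orbits of a consistent scheme is differentiable and solves the equation. The start of the
orbit may vary with the step size. -/
theorem exists_isSolution [ProperSpace E] (hT : IsScheme ξ C T) (𝒰 : Ultrafilter (ℕ × E))
    (h𝒰 : Tendsto Prod.fst (𝒰 : Filter (ℕ × E)) atTop) {w₀ : E}
    (hw₀ : Tendsto Prod.snd (𝒰 : Filter (ℕ × E)) (𝓝 w₀)) :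
    ∃ u : ℝ → E, IsSolution ξ u ∧ ∀ t : ℝ, 0 ≤ t →
      Tendsto (fun p : ℕ × E => (T p.1)^[⌊t * (p.1 + 1)⌋₊] p.2) 𝒰 (𝓝 (u t)) := by
  have hC : 0 ≤ C := by
    have := (norm_nonneg _).trans (hT.norm_sub_le 0 w₀)
    simpa using this
  have hlim : ∀ t : ℝ, 0 ≤ t → ∃ v : E,
      Tendsto (fun p : ℕ × E => (T p.1)^[⌊t * (p.1 + 1)⌋₊] p.2) 𝒰 (𝓝 v) := by
    intro t ht
    have hb : ∀ᶠ p in (𝒰 : Filter (ℕ × E)),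
        (T p.1)^[⌊t * (p.1 + 1)⌋₊] p.2 ∈ Metric.closedBall w₀ (1 + t * C) := by
      filter_upwards [hw₀ (Metric.ball_mem_nhds w₀ one_pos)] with p hp
      have h1 : ‖p.2 - w₀‖ < 1 := by simpa [dist_eq_norm] using hp
      have h2 := hT.norm_iterate_sub_le p.1 p.2 (Nat.zero_le ⌊t * (p.1 + 1)⌋₊)
      have h3 : (⌊t * (p.1 + 1)⌋₊ : ℝ) ≤ t * (p.1 + 1) := Nat.floor_le (by positivity)
      have h4 : ((⌊t * (p.1 + 1)⌋₊ : ℝ) - (0 : ℕ)) * (C / (p.1 + 1)) ≤ t * C := by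
        calc _ ≤ (t * (p.1 + 1)) * (C / (p.1 + 1)) := by
              gcongr
              simpa using h3
          _ = t * C := by field_simp
      rw [Metric.mem_closedBall, dist_eq_norm]
      calc _ = ‖((T p.1)^[⌊t * (p.1 + 1)⌋₊] p.2 - p.2) + (p.2 - w₀)‖ := by congr 1; abel
        _ ≤ _ := (norm_add_le _ _).trans (by
          rw [Function.iterate_zero_apply] at h2; linarith)
    obtain ⟨v, -, hv⟩ := (isCompact_closedBall w₀ (1 + t * C)).ultrafilter_le_nhds
      (𝒰.map fun p : ℕ × E => (T p.1)^[⌊t * (p.1 + 1)⌋₊] p.2) (le_principal_iff.2 hb)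
    exact ⟨v, hv⟩
  choose! u hu using hlim
  refine ⟨u, ?_, hu⟩
  have hfloor : ∀ t : ℝ, 0 ≤ t → Tendsto
      (fun p : ℕ × E => (⌊t * (p.1 + 1)⌋₊ : ℝ) / (p.1 + 1)) 𝒰 (𝓝 t) :=
    fun t ht => (tendsto_floor_div ht).comp h𝒰
  -- The discrete increments over the time interval `[a, b]` pass to the limit.
  have key : ∀ t : ℝ, 0 ≤ t → ∀ ε > 0, ∃ δ > 0, ∀ a b : ℝ, 0 ≤ a → a ≤ b → a ≤ t → t ≤ b → b - a < δ →
      ‖u b - u a - (b - a) • ξ (u t)‖ ≤ (b - a) * ε := by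
    intro t ht ε hε
    obtain ⟨δ, hδ, hcons⟩ := hT.consistent (u t) ε hε
    refine ⟨δ / (2 * (C + 1)), by positivity, fun a b ha hab hat htb hba => ?_⟩
    have hb : 0 ≤ b := ha.trans hab
    have hL : Tendsto (fun p : ℕ × E => ‖(T p.1)^[⌊b * (p.1 + 1)⌋₊] p.2
        - (T p.1)^[⌊a * (p.1 + 1)⌋₊] p.2
        - ((⌊b * (p.1 + 1)⌋₊ : ℝ) / (p.1 + 1) - (⌊a * (p.1 + 1)⌋₊ : ℝ) / (p.1 + 1)) • ξ (u t)‖)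
        𝒰 (𝓝 ‖u b - u a - (b - a) • ξ (u t)‖) :=
      (((hu b hb).sub (hu a ha)).sub
        (((hfloor b hb).sub (hfloor a ha)).smul_const (ξ (u t)))).norm
    have hR := ((hfloor b hb).sub (hfloor a ha)).mul_const ε
    refine le_of_tendsto_of_tendsto hL hR ?_
    have hCba : C * (b - a) < δ / 2 := by
      have hd : (b - a) * (2 * (C + 1)) < δ := (lt_div_iff₀ (by positivity)).1 hba
      nlinarith
    have hclose : ∀ᶠ p in (𝒰 : Filter (ℕ × E)),
        C * ((⌊b * (p.1 + 1)⌋₊ : ℝ) / (p.1 + 1) - (⌊a * (p.1 + 1)⌋₊ : ℝ) / (p.1 + 1)) < δ / 2 :=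
      (((hfloor b hb).sub (hfloor a ha)).const_mul C).eventually_lt_const hCba
    have hnear := hu t ht (Metric.ball_mem_nhds (u t) (half_pos hδ))
    filter_upwards [h𝒰.eventually hcons, hclose, hnear] with p hp hpc hpn
    have hpn' : ‖(T p.1)^[⌊t * (p.1 + 1)⌋₊] p.2 - u t‖ < δ / 2 := by
      simpa [dist_eq_norm] using hpn
    have hm : (0 : ℝ) < p.1 + 1 := by positivity
    have hfa : ⌊a * ((p.1 : ℝ) + 1)⌋₊ ≤ ⌊t * ((p.1 : ℝ) + 1)⌋₊ := Nat.floor_mono (by gcongr)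
    have hfb : ⌊t * ((p.1 : ℝ) + 1)⌋₊ ≤ ⌊b * ((p.1 : ℝ) + 1)⌋₊ := Nat.floor_mono (by gcongr)
    have hfa' : (⌊a * ((p.1 : ℝ) + 1)⌋₊ : ℝ) ≤ ⌊t * ((p.1 : ℝ) + 1)⌋₊ := by exact_mod_cast hfa
    have hfb' : (⌊t * ((p.1 : ℝ) + 1)⌋₊ : ℝ) ≤ ⌊b * ((p.1 : ℝ) + 1)⌋₊ := by exact_mod_cast hfb
    have hstep := norm_sub_sub_smul_le_of_increments (fun k => (T p.1)^[k] p.2) (ξ (u t))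
      (1 / (p.1 + 1)) (ε / (p.1 + 1)) (hfa.trans hfb) fun k hk hk' => by
        have hkt : ‖(T p.1)^[k] p.2 - u t‖ < δ := by
          have hdist : ‖(T p.1)^[k] p.2 - (T p.1)^[⌊t * (p.1 + 1)⌋₊] p.2‖ < δ / 2 := by
            refine lt_of_le_of_lt ?_ hpc
            have hkr : (⌊a * ((p.1 : ℝ) + 1)⌋₊ : ℝ) ≤ k := by exact_mod_cast hk
            have hkr' : (k : ℝ) ≤ ⌊b * ((p.1 : ℝ) + 1)⌋₊ := by exact_mod_cast hk'.le
            have e : C * ((⌊b * (p.1 + 1)⌋₊ : ℝ) / (p.1 + 1) - (⌊a * (p.1 + 1)⌋₊ : ℝ) / (p.1 + 1))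
                = ((⌊b * ((p.1 : ℝ) + 1)⌋₊ : ℝ) - ⌊a * ((p.1 : ℝ) + 1)⌋₊) * (C / (p.1 + 1)) := by
              ring
            rw [e]
            rcases le_total k ⌊t * ((p.1 : ℝ) + 1)⌋₊ with h | h
            · rw [norm_sub_rev]
              refine (hT.norm_iterate_sub_le p.1 p.2 h).trans ?_
              gcongr
            · refine (hT.norm_iterate_sub_le p.1 p.2 h).trans ?_
              gcongr
          calc ‖(T p.1)^[k] p.2 - u t‖
              = ‖((T p.1)^[k] p.2 - (T p.1)^[⌊t * (p.1 + 1)⌋₊] p.2)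
                + ((T p.1)^[⌊t * (p.1 + 1)⌋₊] p.2 - u t)‖ := by congr 1; abel
            _ < δ := (norm_add_le _ _).trans_lt (by linarith)
        simpa [Function.iterate_succ_apply'] using hp _ hkt
    have e : (⌊b * (p.1 + 1)⌋₊ : ℝ) / (p.1 + 1) - (⌊a * (p.1 + 1)⌋₊ : ℝ) / (p.1 + 1)
        = ((⌊b * ((p.1 : ℝ) + 1)⌋₊ : ℝ) - ⌊a * ((p.1 : ℝ) + 1)⌋₊) * (1 / (p.1 + 1)) := by ring
    rw [e]
    exact hstep.trans_eq (by ring)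
  intro t ht
  rw [hasDerivWithinAt_iff_isLittleO, Asymptotics.isLittleO_iff]
  intro ε hε
  obtain ⟨δ, hδ, hkey⟩ := key t ht ε hε
  filter_upwards [inter_mem_nhdsWithin (Set.Ici 0) (Metric.ball_mem_nhds t hδ)] with s hs
  have hs0 : 0 ≤ s := hs.1
  have hst : |s - t| < δ := by simpa [Real.dist_eq] using hs.2
  rw [Real.norm_eq_abs]
  rcases le_total t s with h | h
  · rw [abs_of_nonneg (sub_nonneg.2 h)] at hst ⊢
    rw [mul_comm]
    exact hkey t s ht h le_rfl h hst
  · rw [abs_of_nonpos (sub_nonpos.2 h), neg_sub] at hst ⊢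
    have := hkey s t hs0 h h le_rfl hst
    rw [← norm_neg, mul_comm]
    have e : -(u s - u t - (s - t) • ξ (u t)) = u t - u s - (t - s) • ξ (u t) := by module
    rwa [e]

end IsScheme

end Schemes

/-! ### Recurrence for volume-preserving schemes -/

section Recurrence

open scoped ENNReal BoundedContinuousFunction

/-- A property that holds almost surely passes to the image of almost every point under a
continuous map. No measurability of the image is needed: the property holds on compact sets of
almost full measure, whose images are compact. -/
theorem ae_map_exists_of_ae {Ω E : Type*} [TopologicalSpace Ω] [PolishSpace Ω] [MeasurableSpace Ω]
    [BorelSpace Ω] [TopologicalSpace E] [T2Space E] [MeasurableSpace E] [BorelSpace E]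
    {P : Measure Ω} [IsFiniteMeasure P] {f : Ω → E} (hf : Continuous f) {p : Ω → Prop}
    (hp : ∀ᵐ z ∂P, p z) : ∀ᵐ e ∂(P.map f), ∃ z, p z ∧ f z = e := by
  have hN : P (toMeasurable P {z | ¬ p z}) = 0 := by rw [measure_toMeasurable]; exact hp
  have hM : MeasurableSet (toMeasurable P {z | ¬ p z})ᶜ := (measurableSet_toMeasurable _ _).compl
  refine le_antisymm (le_of_forall_pos_le_add fun ε hε => ?_) bot_le
  rw [zero_add]
  obtain ⟨K, hKM, hK, hKε⟩ := hM.exists_isCompact_sdiff_lt (measure_ne_top P _) hε.ne'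
  have hfK : MeasurableSet (f '' K)ᶜ := (hK.image hf).isClosed.measurableSet.compl
  calc P.map f {e | ¬ ∃ z, p z ∧ f z = e} ≤ P.map f (f '' K)ᶜ := by
        refine measure_mono ?_
        rintro e he ⟨z, hz, rfl⟩
        refine he ⟨z, ?_, rfl⟩
        by_contra hpz
        exact hKM hz (subset_toMeasurable _ _ hpz)
    _ = P (f ⁻¹' (f '' K)ᶜ) := Measure.map_apply hf.measurable hfK
    _ ≤ P (toMeasurable P {z | ¬ p z} ∪ ((toMeasurable P {z | ¬ p z})ᶜ \ K)) := by
        refine measure_mono fun z hz => ?_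
        by_cases h : z ∈ toMeasurable P {z | ¬ p z}
        · exact Or.inl h
        · exact Or.inr ⟨h, fun hK => hz ⟨z, hK, rfl⟩⟩
    _ ≤ 0 + ε := (measure_union_le _ _).trans (add_le_add hN.le hKε.le)
    _ = ε := zero_add ε

/-- For sets `A` and `S` of equal finite measure, `A \ S` and `S \ A` have equal measure. -/
theorem abs_setIntegral_sub_setIntegral_le {E : Type*} [MeasurableSpace E] {μ : Measure E}
    {A S : Set E} (hA : MeasurableSet A) (hS : MeasurableSet S) (hAS : μ A = μ S)
    (hfin : μ S ≠ ⊤) {g : E → ℝ} (hg : Measurable g) {M : ℝ} (hM : ∀ w, |g w| ≤ M) :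
    |∫ w in S, g w ∂μ - ∫ w in A, g w ∂μ| ≤ 2 * M * μ.real (S \ A) := by
  have hfinA : μ A ≠ ⊤ := hAS ▸ hfin
  have hi : ∀ B : Set E, μ B ≠ ⊤ → IntegrableOn g B μ := fun B hB =>
    Measure.integrableOn_of_bounded hB hg.aestronglyMeasurable (ae_of_all _ hM)
  have hb : ∀ B : Set E, μ B ≠ ⊤ → |∫ w in B, g w ∂μ| ≤ M * μ.real B := fun B hB => by
    simpa using norm_setIntegral_le_of_norm_le_const (f := g) hB.lt_top fun w _ => hM w
  have h1 := integral_inter_add_sdiff hA (hi S hfin)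
  have h2 := integral_inter_add_sdiff hS (hi A hfinA)
  have h3 : μ.real (A \ S) = μ.real (S \ A) := by
    have e1 := measureReal_inter_add_sdiff (μ := μ) (s := S) (t := A) hA hfin
    have e2 := measureReal_inter_add_sdiff (μ := μ) (s := A) (t := S) hS hfinA
    have e3 : μ.real A = μ.real S := by simp [measureReal_def, hAS]
    rw [Set.inter_comm] at e2
    linarith
  have h4 := hb (S \ A) (ne_top_of_le_ne_top hfin (measure_mono Set.sdiff_subset))
  have h5 := hb (A \ S) (ne_top_of_le_ne_top hfinA (measure_mono Set.sdiff_subset))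
  rw [h3] at h5
  rw [Set.inter_comm A S] at h2
  have h6 : ∫ w in S, g w ∂μ - ∫ w in A, g w ∂μ
      = ∫ w in S \ A, g w ∂μ - ∫ w in A \ S, g w ∂μ := by linarith
  rw [h6]
  have := abs_sub (∫ w in S \ A, g w ∂μ) (∫ w in A \ S, g w ∂μ)
  linarith

/-- The discrete orbit of a scheme with time step `1 / (n + 1)`, sampled at integer times. -/
def sampledOrbit {E : Type*} (T : ℕ → E → E) (n : ℕ) (w : E) (k : ℕ) : E := ((T n)^[n + 1])^[k] w

theorem sampledOrbit_eq {E : Type*} (T : ℕ → E → E) (n k : ℕ) (w : E) :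
    sampledOrbit T n w k = (T n)^[⌊(k : ℝ) * (n + 1)⌋₊] w := by
  have : ⌊(k : ℝ) * (n + 1)⌋₊ = (n + 1) * k := by
    rw [show (k : ℝ) * (n + 1) = (((n + 1) * k : ℕ) : ℝ) by push_cast; ring, Nat.floor_natCast]
  rw [sampledOrbit, this, Function.iterate_mul]

variable {E : Type*} [NormedAddCommGroup E] [NormedSpace ℝ E]

namespace IsScheme

variable {ξ : E → E} {C : ℝ} {T : ℕ → E → E}

theorem exists_isSolution_from [ProperSpace E] (hT : IsScheme ξ C T) (w₀ : E) :
    ∃ u, IsSolution ξ u ∧ u 0 = w₀ := by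
  obtain ⟨u, hu, hlim⟩ := hT.exists_isSolution ((hyperfilter ℕ).map fun n => (n, w₀))
    (tendsto_map'_iff.2 (Nat.hyperfilter_le_atTop)) (w₀ := w₀)
    (tendsto_map'_iff.2 tendsto_const_nhds)
  refine ⟨u, hu, tendsto_nhds_unique (hlim 0 le_rfl) ?_⟩
  simp only [zero_mul, Nat.floor_zero, Function.iterate_zero_apply]
  exact tendsto_map'_iff.2 tendsto_const_nhds

/-- A sequence all of whose neighbourhoods contain sampled orbits of arbitrarily small step sizes
consists of the values of a solution at the integers. -/
theorem exists_isSolution_of_frequently [ProperSpace E] (hT : IsScheme ξ C T) (z : ℕ → E)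
    (hz : ∀ V ∈ 𝓝 z, ∃ᶠ n in atTop, ∃ w, sampledOrbit T n w ∈ V) :
    ∃ u, IsSolution ξ u ∧ ∀ k : ℕ, u k = z k := by
  have hne : (comap Prod.fst atTop ⊓
      comap (fun p : ℕ × E => sampledOrbit T p.1 p.2) (𝓝 z)).NeBot := by
    rw [inf_neBot_iff]
    rintro s ⟨s', hs', hs⟩ t ⟨V, hV, ht⟩
    obtain ⟨n, ⟨w, hw⟩, hn⟩ := ((hz V hV).and_eventually hs').exists
    exact ⟨(n, w), hs hn, ht hw⟩
  set 𝒰 := Ultrafilter.of (comap Prod.fst atTop ⊓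
      comap (fun p : ℕ × E => sampledOrbit T p.1 p.2) (𝓝 z))
  have h𝒰 := Ultrafilter.of_le (comap Prod.fst atTop ⊓
      comap (fun p : ℕ × E => sampledOrbit T p.1 p.2) (𝓝 z))
  have h1 : Tendsto Prod.fst (𝒰 : Filter (ℕ × E)) atTop :=
    tendsto_comap.mono_left (h𝒰.trans inf_le_left)
  have h2 : Tendsto (fun p : ℕ × E => sampledOrbit T p.1 p.2) 𝒰 (𝓝 z) :=
    tendsto_comap.mono_left (h𝒰.trans inf_le_right)
  rw [tendsto_pi_nhds] at h2
  obtain ⟨u, hu, hlim⟩ := hT.exists_isSolution 𝒰 h1 (h2 0)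
  refine ⟨u, hu, fun k => tendsto_nhds_unique (hlim k k.cast_nonneg) ?_⟩
  simp only [← sampledOrbit_eq]
  exact h2 k

/-- If no solution leaves the compact set `S` within one unit of time, then the time-one map of the
scheme maps `S` into any given neighbourhood of `S`, for small step sizes. -/
theorem eventually_iterate_mem [ProperSpace E] (hT : IsScheme ξ C T) {S U : Set E}
    (hS : IsCompact S) (hinv : ∀ u, IsSolution ξ u → u 0 ∈ S → u 1 ∈ S) (hU : IsOpen U)
    (hSU : S ⊆ U) : ∀ᶠ n in atTop, ∀ w ∈ S, (T n)^[n + 1] w ∈ U := by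
  by_contra hcon
  have hne : (comap Prod.fst atTop ⊓
      𝓟 {p : ℕ × E | p.2 ∈ S ∧ (T p.1)^[p.1 + 1] p.2 ∉ U}).NeBot := by
    rw [inf_principal_neBot_iff]
    rintro s ⟨s', hs', hs⟩
    obtain ⟨n, hn, hn'⟩ := ((not_eventually.1 hcon).and_eventually hs').exists
    push Not at hn
    obtain ⟨w, hw⟩ := hn
    exact ⟨(n, w), hs hn', hw⟩
  set 𝒰 := Ultrafilter.of (comap Prod.fst atTop ⊓
      𝓟 {p : ℕ × E | p.2 ∈ S ∧ (T p.1)^[p.1 + 1] p.2 ∉ U})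
  have h𝒰 := Ultrafilter.of_le (comap Prod.fst atTop ⊓
      𝓟 {p : ℕ × E | p.2 ∈ S ∧ (T p.1)^[p.1 + 1] p.2 ∉ U})
  have h1 : Tendsto Prod.fst (𝒰 : Filter (ℕ × E)) atTop :=
    tendsto_comap.mono_left (h𝒰.trans inf_le_left)
  have h2 : ∀ᶠ p in (𝒰 : Filter (ℕ × E)), p.2 ∈ S ∧ (T p.1)^[p.1 + 1] p.2 ∉ U :=
    le_principal_iff.1 (h𝒰.trans inf_le_right)
  obtain ⟨w₀, hw₀, hw₀'⟩ := hS.ultrafilter_le_nhds (𝒰.map Prod.snd)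
    (le_principal_iff.2 (h2.mono fun _ h => h.1))
  obtain ⟨u, hu, hlim⟩ := hT.exists_isSolution 𝒰 h1 (w₀ := w₀) hw₀'
  have hu0 : u 0 = w₀ := by
    refine tendsto_nhds_unique (hlim 0 le_rfl) ?_
    simp only [zero_mul, Nat.floor_zero, Function.iterate_zero_apply]
    exact hw₀'
  have hu1 := hlim 1 zero_le_one
  have h3 : u 1 ∈ Uᶜ := by
    refine hU.isClosed_compl.mem_of_tendsto hu1 (h2.mono fun p hp => ?_)
    have : ⌊(1 : ℝ) * (p.1 + 1)⌋₊ = p.1 + 1 := by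
      rw [one_mul]; exact_mod_cast Nat.floor_natCast (R := ℝ) (p.1 + 1)
    rw [this]
    exact hp.2
  exact h3 (hSU (hinv u hu (hu0 ▸ hw₀)))

variable [MeasurableSpace E] [BorelSpace E]

/-- In the limit the time-one maps of the scheme leave `S` invariant up to null sets: the part of
`S` that leaves `S` lands in a small neighbourhood of `S`, and the scheme preserves `μ`. -/
theorem tendsto_measureReal_sdiff [ProperSpace E] (hT : IsScheme ξ C T) {μ : Measure E}
    [μ.OuterRegular] [IsFiniteMeasureOnCompacts μ] (hμ : ∀ n, MeasurePreserving (T n) μ μ)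
    {S : Set E} (hS : IsCompact S) (hinv : ∀ u, IsSolution ξ u → u 0 ∈ S → u 1 ∈ S) :
    Tendsto (fun n => μ.real (S \ (T n)^[n + 1] ⁻¹' S)) atTop (𝓝 0) := by
  have hlim : Tendsto (fun n => μ (S \ (T n)^[n + 1] ⁻¹' S)) atTop (𝓝 0) := by
    rw [ENNReal.tendsto_nhds_zero]
    intro ε hε
    obtain ⟨U, hSU, hU, -, hUε⟩ := hS.measurableSet.exists_isOpen_sdiff_lt
      (hS.measure_lt_top (μ := μ)).ne hε.ne'
    filter_upwards [hT.eventually_iterate_mem hS hinv hU hSU] with n hn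
    calc μ (S \ (T n)^[n + 1] ⁻¹' S) ≤ μ ((T n)^[n + 1] ⁻¹' (U \ S)) :=
          measure_mono fun w hw => ⟨hn w hw.1, hw.2⟩
      _ = μ (U \ S) := ((hμ n).iterate (n + 1)).measure_preimage
          (hU.measurableSet.diff hS.measurableSet).nullMeasurableSet
      _ ≤ ε := hUε.le
  have := (ENNReal.tendsto_toReal ENNReal.zero_ne_top).comp hlim
  simpa [Function.comp_def, measureReal_def] using this

end IsScheme

end Recurrence

section RecurrenceLaw

open scoped ENNReal BoundedContinuousFunction

theorem measurable_sampledOrbit {E : Type*} [MeasurableSpace E] {T : ℕ → E → E}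
    (hT : ∀ n, Measurable (T n)) (n : ℕ) : Measurable (sampledOrbit T n) :=
  measurable_pi_lambda _ fun k => ((hT n).iterate (n + 1)).iterate k

theorem sampledOrbit_succ {E : Type*} (T : ℕ → E → E) (n : ℕ) (w : E) :
    (fun k => sampledOrbit T n w (k + 1)) = sampledOrbit T n ((T n)^[n + 1] w) := by
  funext k
  simp only [sampledOrbit, Function.iterate_succ_apply]

variable {E : Type*} [NormedAddCommGroup E] [NormedSpace ℝ E]

namespace IsScheme

variable {ξ : E → E} {C : ℝ} {T : ℕ → E → E}

theorem sampledOrbit_mem_closedBall (hT : IsScheme ξ C T) {R : ℝ} {w : E} (hw : ‖w‖ ≤ R)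
    (n k : ℕ) : sampledOrbit T n w k ∈ Metric.closedBall (0 : E) (R + k * C) := by
  have h := hT.norm_iterate_sub_le n w (Nat.zero_le ((n + 1) * k))
  rw [Function.iterate_zero_apply, Function.iterate_mul] at h
  have e : (((n + 1) * k : ℕ) - ((0 : ℕ) : ℝ)) * (C / (n + 1)) = k * C := by
    push_cast
    field_simp
    ring
  rw [e] at h
  rw [mem_closedBall_zero_iff]
  calc ‖sampledOrbit T n w k‖ = ‖(((T n)^[n + 1])^[k] w - w) + w‖ := by
        rw [sub_add_cancel]; rfl
    _ ≤ R + k * C := (norm_add_le _ _).trans (by linarith)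

variable [MeasurableSpace E] [BorelSpace E] [ProperSpace E]

/-- If the steps of the scheme preserve `μ` and the solutions starting in the compact set `S` are
in `S` at time `1`, then the laws of the sampled orbits started from the uniform distribution on `S`
have a limit that is carried by samples of solutions and is invariant under the shift. The latter is
due to `IsScheme.tendsto_measureReal_sdiff`. -/
theorem exists_shift_invariant_law (hT : IsScheme ξ C T) {μ : Measure E}
    [μ.OuterRegular] [IsFiniteMeasureOnCompacts μ] (hμ : ∀ n, MeasurePreserving (T n) μ μ)
    {S : Set E} (hS : IsCompact S) (hinv : ∀ u, IsSolution ξ u → u 0 ∈ S → u 1 ∈ S)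
    (hS0 : μ S ≠ 0) :
    ∃ P : ProbabilityMeasure (ℕ → E),
      (P : Measure (ℕ → E)).map (fun z k => z (k + 1)) = P ∧
      (P : Measure (ℕ → E)).map (fun z => z 0) = ProbabilityTheory.cond μ S ∧
      ∀ᵐ z ∂(P : Measure (ℕ → E)), ∃ u, IsSolution ξ u ∧ ∀ k : ℕ, u k = z k := by
  have hStop : μ S ≠ ⊤ := hS.measure_lt_top.ne
  have hν : IsProbabilityMeasure (ProbabilityTheory.cond μ S) :=
    ProbabilityTheory.cond_isProbabilityMeasure_of_finite hS0 hStop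
  have hO := measurable_sampledOrbit fun n => (hμ n).measurable
  let ν : ProbabilityMeasure E := ⟨ProbabilityTheory.cond μ S, hν⟩
  let law : ℕ → ProbabilityMeasure (ℕ → E) := fun n => ν.map (hO n).aemeasurable
  have hlaw : ∀ n, (law n : Measure (ℕ → E)) =
      (ProbabilityTheory.cond μ S).map (sampledOrbit T n) := fun n => rfl
  obtain ⟨R, hR⟩ := hS.isBounded.exists_norm_le
  -- All the laws are carried by one compact product of balls.
  have htight : IsTightMeasureSet
      {((P : ProbabilityMeasure (ℕ → E)) : Measure (ℕ → E)) | P ∈ Set.range law} := by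
    rw [isTightMeasureSet_iff_exists_isCompact_measure_compl_le]
    intro ε _
    have hK : IsCompact (Set.univ.pi fun k : ℕ => Metric.closedBall (0 : E) (R + k * C)) :=
      isCompact_univ_pi fun k => isCompact_closedBall _ _
    refine ⟨_, hK, ?_⟩
    rintro _ ⟨_, ⟨n, rfl⟩, rfl⟩
    rw [hlaw, Measure.map_apply (hO n) hK.measurableSet.compl]
    refine le_of_eq_of_le ?_ zero_le
    refine measure_mono_null ?_
      (show ProbabilityTheory.cond μ S Sᶜ = 0 from ProbabilityTheory.ae_cond_mem hS.measurableSet)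
    exact fun w hw hwS => hw fun k _ => hT.sampledOrbit_mem_closedBall (hR w hwS) n k
  obtain ⟨P, -, hP⟩ := (isCompact_closure_of_isTightMeasureSet htight).ultrafilter_le_nhds
    ((hyperfilter ℕ).map law)
    (le_principal_iff.2 (mem_map.2 (univ_mem' fun n => subset_closure ⟨n, rfl⟩)))
  have hP : Tendsto law (hyperfilter ℕ) (𝓝 P) := hP
  have hcs : Continuous fun (z : ℕ → E) (k : ℕ) => z (k + 1) :=
    continuous_pi fun k => continuous_apply (k + 1)
  refine ⟨P, ?_, ?_, ?_⟩
  · have hfin : IsFiniteMeasure ((P : Measure (ℕ → E)).map fun z k => z (k + 1)) :=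
      Measure.isFiniteMeasure_map _ _
    refine ext_of_forall_integral_eq_of_IsFiniteMeasure fun f => ?_
    rw [integral_map hcs.measurable.aemeasurable f.continuous.aestronglyMeasurable]
    have hlim := ProbabilityMeasure.tendsto_iff_forall_integral_tendsto.1 hP
    have h1 := hlim f
    have h2 := hlim (f.compContinuous ⟨_, hcs⟩)
    have h3 : Tendsto (fun n => ∫ z, f.compContinuous ⟨_, hcs⟩ z ∂(law n : Measure (ℕ → E))
        - ∫ z, f z ∂(law n : Measure (ℕ → E))) (hyperfilter ℕ) (𝓝 0) := by
      have h4 := ((hT.tendsto_measureReal_sdiff hμ hS hinv).const_mul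
        ((μ.real S)⁻¹ * (2 * ‖f‖))).mono_left Nat.hyperfilter_le_atTop
      rw [mul_zero] at h4
      refine squeeze_zero_norm (fun n => ?_) h4
      have hg : Measurable fun w => f (sampledOrbit T n w) :=
        f.continuous.measurable.comp (hO n)
      have hΦ := (hμ n).iterate (n + 1)
      have e1 : ∫ z, f z ∂(law n : Measure (ℕ → E))
          = (μ.real S)⁻¹ * ∫ w in (T n)^[n + 1] ⁻¹' S,
              f (sampledOrbit T n ((T n)^[n + 1] w)) ∂μ := by
        rw [hlaw, integral_map (hO n).aemeasurable f.continuous.aestronglyMeasurable,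
          ProbabilityTheory.cond, integral_smul_measure,
          ← setIntegral_map (f := fun w => f (sampledOrbit T n w)) hS.measurableSet
            hg.aestronglyMeasurable hΦ.measurable.aemeasurable, hΦ.map_eq]
        simp [measureReal_def]
      have e2 : ∫ z, f.compContinuous ⟨_, hcs⟩ z ∂(law n : Measure (ℕ → E))
          = (μ.real S)⁻¹ * ∫ w in S, f (sampledOrbit T n ((T n)^[n + 1] w)) ∂μ := by
        rw [hlaw, integral_map (hO n).aemeasurable
          (f.compContinuous ⟨_, hcs⟩).continuous.aestronglyMeasurable,
          ProbabilityTheory.cond, integral_smul_measure]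
        simp [measureReal_def, sampledOrbit_succ]
      rw [e1, e2, ← mul_sub, Real.norm_eq_abs, abs_mul, abs_of_nonneg (by positivity), mul_assoc]
      gcongr
      exact abs_setIntegral_sub_setIntegral_le (hΦ.measurable hS.measurableSet) hS.measurableSet
        (hΦ.measure_preimage hS.measurableSet.nullMeasurableSet) hStop
        (hg.comp hΦ.measurable) fun w => f.norm_coe_le_norm _
    have h5 := tendsto_nhds_unique h3 (h2.sub h1)
    exact sub_eq_zero.1 h5.symm
  · have hc0 : Continuous fun z : ℕ → E => z 0 := continuous_apply 0
    have h1 := ProbabilityMeasure.tendsto_map_of_tendsto_of_continuous law P hP hc0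
    have h2 : ∀ n, (law n).map hc0.measurable.aemeasurable = ν := by
      intro n
      apply Subtype.ext
      change ((ProbabilityTheory.cond μ S).map (sampledOrbit T n)).map _ = _
      rw [Measure.map_map hc0.measurable (hO n)]
      exact Measure.map_id
    have h3 := tendsto_nhds_unique (h1.congr h2) tendsto_const_nhds
    exact congrArg Subtype.val h3
  · refine measure_null_of_locally_null _ fun z hz => ?_
    have h1 : ¬ ∀ V ∈ 𝓝 z, ∃ᶠ n in atTop, ∃ w, sampledOrbit T n w ∈ V :=
      fun h => hz (hT.exists_isSolution_of_frequently z h)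
    push Not at h1
    obtain ⟨V, hV, hn⟩ := h1
    obtain ⟨W, hWV, hW, hzW⟩ := mem_nhds_iff.1 hV
    refine ⟨W, mem_nhdsWithin_of_mem_nhds (hW.mem_nhds hzW), ?_⟩
    have h2 := ProbabilityMeasure.le_liminf_measure_open_of_tendsto hP hW
    have h3 : ∀ᶠ n in (hyperfilter ℕ : Filter ℕ), (law n : Measure (ℕ → E)) W = 0 := by
      filter_upwards [Nat.hyperfilter_le_atTop hn] with n hn
      rw [hlaw, Measure.map_apply (hO n) hW.measurableSet]
      have : sampledOrbit T n ⁻¹' W = ∅ :=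
        Set.eq_empty_of_forall_notMem fun w hw => hn w (hWV hw)
      rw [this, measure_empty]
    rw [liminf_congr h3, liminf_const] at h2
    exact le_antisymm h2 bot_le

/-- **Poincaré recurrence without uniqueness**: recurrence of the shift with respect to the
invariant law gives a recurrent solution through almost every point of `S`. -/
theorem ae_exists_recurrent (hT : IsScheme ξ C T) {μ : Measure E}
    [μ.OuterRegular] [IsFiniteMeasureOnCompacts μ] (hμ : ∀ n, MeasurePreserving (T n) μ μ)
    {S : Set E} (hS : IsCompact S) (hinv : ∀ u, IsSolution ξ u → u 0 ∈ S → u 1 ∈ S) :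
    ∀ᵐ w ∂μ, w ∈ S → ∃ u, IsSolution ξ u ∧ u 0 = w ∧ IsRecurrent u := by
  rcases eq_or_ne (μ S) 0 with hS0 | hS0
  · exact (measure_eq_zero_iff_ae_notMem.1 hS0).mono fun w h h' => absurd h' h
  obtain ⟨P, hshift, hstart, hsol⟩ := hT.exists_shift_invariant_law hμ hS hinv hS0
  have hcs : Continuous fun (z : ℕ → E) (k : ℕ) => z (k + 1) :=
    continuous_pi fun k => continuous_apply (k + 1)
  have hpres : MeasurePreserving (fun (z : ℕ → E) k => z (k + 1))
      (P : Measure (ℕ → E)) (P : Measure (ℕ → E)) := ⟨hcs.measurable, hshift⟩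
  have hrec := hpres.conservative.ae_frequently_mem_of_mem_nhds
  have hiter : ∀ (n : ℕ) (z : ℕ → E), (fun (z : ℕ → E) k => z (k + 1))^[n] z 0 = z n := by
    have : ∀ (n : ℕ) (z : ℕ → E) (k : ℕ),
        (fun (z : ℕ → E) k => z (k + 1))^[n] z k = z (k + n) := by
      intro n
      induction n with
      | zero => intro z k; rfl
      | succ n ih =>
        intro z k
        rw [Function.iterate_succ_apply, ih]
        rfl
    intro n z
    simpa using this n z 0
  have hgood : ∀ᵐ z ∂(P : Measure (ℕ → E)), ∃ u, IsSolution ξ u ∧ u 0 = z 0 ∧ IsRecurrent u := by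
    filter_upwards [hrec, hsol] with z hz hu
    obtain ⟨u, hu, huz⟩ := hu
    have hu0 : u 0 = z 0 := by simpa using huz 0
    refine ⟨u, hu, hu0, ?_⟩
    have hcl : MapClusterPt (z 0) atTop z := by
      rw [mapClusterPt_iff_frequently]
      intro s hs
      exact (hz ((fun z : ℕ → E => z 0) ⁻¹' s) ((continuous_apply 0).continuousAt hs)).mono
        fun n hn => by simpa [hiter] using hn
    obtain ⟨ψ, hψ, hlim⟩ := hcl.tendsto_subseq
    refine ⟨fun n => (ψ n : ℝ), tendsto_natCast_atTop_atTop.comp hψ.tendsto_atTop, ?_⟩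
    rw [hu0]
    simpa only [huz, Function.comp_def] using hlim
  have hmap := ae_map_exists_of_ae (f := fun z : ℕ → E => z 0) (continuous_apply 0) hgood
  rw [hstart] at hmap
  rw [ProbabilityTheory.cond,
    Measure.ae_ennreal_smul_measure_iff (ENNReal.inv_ne_zero.2 hS.measure_lt_top.ne),
    ae_restrict_iff' hS.measurableSet] at hmap
  filter_upwards [hmap] with w hw hwS
  obtain ⟨z, ⟨u, hu, hu0, hur⟩, hz⟩ := hw hwS
  exact ⟨u, hu, hu0.trans hz, hur⟩

end IsScheme

end RecurrenceLaw

/-! ### Splitting schemes for block fields -/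

section Splitting

variable {X B : Type*}

open Classical in
/-- The Euler step of size `h` for the block `x` of the equation `w' = ξ(w)`, the other blocks being
kept. -/
noncomputable def blockStep [AddCommGroup B] [Module ℝ B] (ξ : (X → B) → X → B) (h : ℝ) (x : X)
    (w : X → B) : X → B :=
  Function.update w x (w x + h • ξ w x)

/-- The Euler steps for the blocks in a list, one after the other. -/
noncomputable def splitStep [AddCommGroup B] [Module ℝ B] (ξ : (X → B) → X → B) (h : ℝ) :
    List X → (X → B) → X → B
  | [], w => w
  | x :: L, w => splitStep ξ h L (blockStep ξ h x w)

/-- The time-`1 / (n + 1)` step that updates every block once. -/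
noncomputable def fullStep [Fintype X] [AddCommGroup B] [Module ℝ B] (ξ : (X → B) → X → B)
    (n : ℕ) : (X → B) → X → B :=
  splitStep ξ (1 / (n + 1)) Finset.univ.toList

theorem splitStep_apply_of_notMem [AddCommGroup B] [Module ℝ B] (ξ : (X → B) → X → B) (h : ℝ)
    {L : List X} {x : X} (hx : x ∉ L) (w : X → B) : splitStep ξ h L w x = w x := by
  classical
  induction L generalizing w with
  | nil => rfl
  | cons y L ih =>
    rw [List.mem_cons, not_or] at hx
    rw [splitStep, ih hx.2, blockStep, Function.update_of_ne hx.1]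

/-- Each block moves once, with a velocity taken at a point reached on the way, which is close to
the starting point. -/
theorem exists_splitStep_apply_eq [Fintype X] [NormedAddCommGroup B] [NormedSpace ℝ B]
    {ξ : (X → B) → X → B} {C : ℝ} (hC : ∀ w, ‖ξ w‖ ≤ C) {h : ℝ} (hh : 0 ≤ h) {L : List X}
    (hL : L.Nodup) {x : X} (hx : x ∈ L) (w : X → B) :
    ∃ w', ‖w' - w‖ ≤ L.length * (h * C) ∧ splitStep ξ h L w x = w x + h • ξ w' x := by
  classical
  have hC0 : 0 ≤ C := (norm_nonneg _).trans (hC w)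
  induction L generalizing w with
  | nil => simp at hx
  | cons y L ih =>
    rw [List.nodup_cons] at hL
    by_cases hxy : x = y
    · subst hxy
      refine ⟨w, by rw [sub_self, norm_zero]; positivity, ?_⟩
      rw [splitStep, splitStep_apply_of_notMem ξ h hL.1, blockStep, Function.update_self]
    · obtain ⟨w', hw', he⟩ := ih hL.2 ((List.mem_cons.1 hx).resolve_left hxy) (blockStep ξ h y w)
      have hy : blockStep ξ h y w x = w x := by rw [blockStep, Function.update_of_ne hxy]
      refine ⟨w', ?_, by rw [splitStep, he, hy]⟩
      have h1 : ‖blockStep ξ h y w - w‖ ≤ h * C := by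
        rw [pi_norm_le_iff_of_nonneg (by positivity)]
        intro z
        rw [Pi.sub_apply, blockStep]
        by_cases hz : z = y
        · subst hz
          rw [Function.update_self, add_sub_cancel_left, norm_smul, Real.norm_of_nonneg hh]
          gcongr
          exact (norm_le_pi_norm _ _).trans (hC w)
        · rw [Function.update_of_ne hz, sub_self, norm_zero]
          positivity
      calc ‖w' - w‖ = ‖(w' - blockStep ξ h y w) + (blockStep ξ h y w - w)‖ := by congr 1; abel
        _ ≤ _ := (norm_add_le _ _).trans (add_le_add hw' h1)
        _ = _ := by push_cast [List.length_cons]; ring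

theorem isScheme_fullStep [Fintype X] [NormedAddCommGroup B] [NormedSpace ℝ B]
    {ξ : (X → B) → X → B} (hξ : Continuous ξ) {C : ℝ} (hC : ∀ w, ‖ξ w‖ ≤ C) :
    IsScheme ξ C (fullStep ξ) := by
  have hstep : ∀ (n : ℕ) (w : X → B) (x : X), ∃ w',
      ‖w' - w‖ ≤ (Fintype.card X * C) / (n + 1) ∧
        fullStep ξ n w x = w x + (1 / (n + 1 : ℝ)) • ξ w' x := by
    intro n w x
    obtain ⟨w', hw', he⟩ := exists_splitStep_apply_eq hC (h := 1 / ((n : ℝ) + 1)) (by positivity)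
      (Finset.nodup_toList Finset.univ) (Finset.mem_toList.2 (Finset.mem_univ x)) w
    refine ⟨w', hw'.trans_eq ?_, he⟩
    rw [Finset.length_toList, Finset.card_univ]
    ring
  constructor
  · intro n w
    have hC0 : 0 ≤ C := (norm_nonneg _).trans (hC w)
    rw [pi_norm_le_iff_of_nonneg (by positivity)]
    intro x
    obtain ⟨w', -, he⟩ := hstep n w x
    rw [Pi.sub_apply, he, add_sub_cancel_left, norm_smul, Real.norm_of_nonneg (by positivity),
      one_div, inv_mul_eq_div]
    gcongr
    exact (norm_le_pi_norm _ _).trans (hC w')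
  · intro w₀ ε hε
    obtain ⟨δ, hδ, hδε⟩ := Metric.continuousAt_iff.1 (hξ.continuousAt (x := w₀)) ε hε
    refine ⟨δ / 2, half_pos hδ, ?_⟩
    have hlim : Tendsto (fun n : ℕ => (Fintype.card X * C) / ((n : ℝ) + 1)) atTop (𝓝 0) :=
      tendsto_const_nhds.div_atTop
        (tendsto_atTop_add_const_right _ _ tendsto_natCast_atTop_atTop)
    filter_upwards [hlim.eventually_lt_const (half_pos hδ)] with n hn w hw
    rw [pi_norm_le_iff_of_nonneg (by positivity)]
    intro x
    obtain ⟨w', hw', he⟩ := hstep n w x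
    have h1 : dist w' w₀ < δ := by
      rw [dist_eq_norm]
      calc ‖w' - w₀‖ = ‖(w' - w) + (w - w₀)‖ := by congr 1; abel
        _ < δ := (norm_add_le _ _).trans_lt (by linarith)
    have h2 : ‖ξ w' x - ξ w₀ x‖ ≤ ε := by
      rw [← Pi.sub_apply]
      refine (norm_le_pi_norm _ _).trans ?_
      rw [← dist_eq_norm]
      exact (hδε h1).le
    rw [Pi.sub_apply, Pi.sub_apply, Pi.smul_apply, he, add_sub_cancel_left, ← smul_sub, norm_smul,
      Real.norm_of_nonneg (by positivity), one_div, inv_mul_eq_div]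
    gcongr

variable [Fintype X] [NormedAddCommGroup B] [NormedSpace ℝ B] [MeasureSpace B] [BorelSpace B]
  [SecondCountableTopology B] [SigmaFinite (volume : Measure B)]
  [(volume : Measure B).IsAddRightInvariant]

open Classical in
/-- A block step is a shear when the block of the field does not depend on that block of the
variables. By Fubini's theorem it preserves volume because translations do; no differentiability of
the field is needed. -/
theorem measurePreserving_blockStep {ξ : (X → B) → X → B} (hξ : Continuous ξ) {x : X}
    (hind : ∀ w z, ξ (Function.update w x z) x = ξ w x) (h : ℝ) :
    MeasurePreserving (blockStep ξ h x) volume volume := by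
  have hcont : Continuous (blockStep ξ h x) := by
    unfold blockStep
    exact continuous_id.update x ((continuous_apply x).add
      (((continuous_apply x).comp hξ).const_smul h))
  refine ⟨hcont.measurable, Measure.ext_of_lintegral _ fun f hf => ?_⟩
  rw [lintegral_map hf hcont.measurable]
  have key : ∀ g : (X → B) → ENNReal, Measurable g → ∫⁻ w, g w =
      (∫⋯∫⁻_Finset.univ.erase x, (fun w => ∫⁻ z, g (Function.update w x z))
        ∂fun _ : X => (volume : Measure B)) 0 := fun g hg => by
    rw [volume_pi, lintegral_eq_lmarginal_univ (0 : X → B),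
      lmarginal_erase' _ hg (Finset.mem_univ x)]
  rw [key (fun w => f (blockStep ξ h x w)) (hf.comp hcont.measurable), key _ hf]
  congr 2
  funext w
  have h1 : ∀ z, blockStep ξ h x (Function.update w x z)
      = Function.update w x (z + h • ξ w x) := fun z => by
    rw [blockStep, hind, Function.update_self, Function.update_idem]
  simp only [h1]
  exact lintegral_add_right_eq_self (fun z => f (Function.update w x z)) (h • ξ w x)

open Classical in
theorem measurePreserving_fullStep {ξ : (X → B) → X → B} (hξ : Continuous ξ)
    (hind : ∀ w x z, ξ (Function.update w x z) x = ξ w x) (n : ℕ) :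
    MeasurePreserving (fullStep ξ n) volume volume := by
  have : ∀ L : List X, MeasurePreserving (splitStep ξ (1 / (n + 1)) L) volume volume := by
    intro L
    induction L with
    | nil => exact MeasurePreserving.id _
    | cons x L ih =>
      exact ih.comp (measurePreserving_blockStep hξ (fun w z => hind w x z) _)
  exact this _

end Splitting

/-! ### Regularizers: the choice map and its potential -/

namespace Regularizer

variable {A : Type*} [Fintype A]

theorem objective_sub_objective (φ : Regularizer A) (y y' p : A → ℝ) :
    φ.objective y' p - φ.objective y p = ∑ a, p a * (y' a - y a) := by
  simp only [objective]
  rw [sub_sub_sub_cancel_right, ← Finset.sum_sub_distrib]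
  exact Finset.sum_congr rfl fun a _ => by ring

theorem abs_sum_mul_le (p v : A → ℝ) :
    |∑ a, p a * v a| ≤ Fintype.card A * (‖p‖ * ‖v‖) := by
  calc |∑ a, p a * v a| ≤ ∑ a, |p a * v a| := Finset.abs_sum_le_sum_abs _ _
    _ ≤ ∑ _a : A, ‖p‖ * ‖v‖ := Finset.sum_le_sum fun a _ => by
        rw [abs_mul]
        exact mul_le_mul (norm_le_pi_norm p a) (norm_le_pi_norm v a) (abs_nonneg _) (norm_nonneg _)
    _ = Fintype.card A * (‖p‖ * ‖v‖) := by simp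

theorem continuous_objective (φ : Regularizer A) :
    Continuous fun z : (A → ℝ) × stdSimplex ℝ A => φ.objective z.1 z.2 := by
  have hφ : Continuous fun q : stdSimplex ℝ A => φ.toFun q :=
    continuousOn_iff_continuous_domRestrict.1 φ.continuousOn
  have hcoe : Continuous fun q : stdSimplex ℝ A => (q : A → ℝ) := continuous_subtype_val
  unfold objective
  refine Continuous.sub ?_ (hφ.comp continuous_snd)
  exact continuous_finsetSum _ fun a _ =>
    ((continuous_apply a).comp continuous_fst).mul
      ((continuous_apply a).comp (hcoe.comp continuous_snd))

variable [Nonempty A]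

theorem choice_sub_const (φ : Regularizer A) (y : A → ℝ) (c : ℝ) :
    φ.choice (fun a => y a - c) = φ.choice y := by
  have h : ∀ q : stdSimplex ℝ A,
      φ.objective (fun a => y a - c) q = φ.objective y q - c := fun q => by
    have := φ.objective_sub_objective y (fun a => y a - c) q
    have hq : ∑ a, (q : A → ℝ) a = 1 := q.2.2
    have e : ∑ a, (q : A → ℝ) a * (y a - c - y a) = -c := by
      simp only [sub_sub_cancel_left, ← Finset.sum_mul, hq, one_mul]
    linarith
  refine φ.eq_choice y _ fun q => ?_
  have := φ.choice_spec (fun a => y a - c) q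
  rw [h, h] at this
  linarith

/-- The choice map has a closed graph, by its variational definition, and a compact target. -/
theorem continuous_choice (φ : Regularizer A) : Continuous φ.choice := by
  have hcompact : CompactSpace (stdSimplex ℝ A) :=
    isCompact_iff_compactSpace.1 (isCompact_stdSimplex ℝ A)
  refine continuous_iff_ultrafilter.2 fun y 𝒰 h𝒰 => ?_
  obtain ⟨p, hp⟩ : ∃ p, Tendsto φ.choice 𝒰 (𝓝 p) := by
    obtain ⟨p, -, hp⟩ := isCompact_univ.ultrafilter_le_nhds (𝒰.map φ.choice)
      (le_principal_iff.2 univ_mem)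
    exact ⟨p, hp⟩
  have hlim : ∀ (r : (A → ℝ) → stdSimplex ℝ A) (s : stdSimplex ℝ A), Tendsto r 𝒰 (𝓝 s) →
      Tendsto (fun z => φ.objective z (r z)) 𝒰 (𝓝 (φ.objective y s)) := by
    intro r s hr
    have h1 : Tendsto (fun z => (z, r z)) (𝒰 : Filter (A → ℝ)) (𝓝 (y, s)) :=
      Tendsto.prodMk_nhds h𝒰 hr
    have h2 := Tendsto.comp (φ.continuous_objective.tendsto (y, s)) h1
    exact h2
  have key : p = φ.choice y := φ.eq_choice y p fun q =>
    le_of_tendsto_of_tendsto' (hlim (fun _ => q) q tendsto_const_nhds) (hlim φ.choice p hp)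
      fun z => φ.choice_spec z q
  rwa [key] at hp

theorem continuous_coe_choice (φ : Regularizer A) :
    Continuous fun y => (φ.choice y : A → ℝ) :=
  continuous_subtype_val.comp φ.continuous_choice

/-- The Fenchel coupling `φ*(y) - (⟨y, q⟩ - φ(q))` of a distribution `q` and scores `y`, where
`φ*(y)` is the maximal objective: the loss in objective when `q` is played instead of the choice. -/
noncomputable def coupling (φ : Regularizer A) (q : stdSimplex ℝ A) (y : A → ℝ) : ℝ :=
  φ.objective y (φ.choice y) - φ.objective y q

theorem coupling_nonneg (φ : Regularizer A) (q : stdSimplex ℝ A) (y : A → ℝ) :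
    0 ≤ φ.coupling q y := sub_nonneg.2 (φ.choice_spec y q)

theorem coupling_eq_zero_iff (φ : Regularizer A) {q : stdSimplex ℝ A} {y : A → ℝ} :
    φ.coupling q y = 0 ↔ φ.choice y = q := by
  constructor
  · intro h
    exact (φ.eq_choice y q fun r => (φ.choice_spec y r).trans_eq (sub_eq_zero.1 h)).symm
  · rintro rfl
    exact sub_self _

/-- Envelope theorem: the gradient of the maximal objective is the choice. -/
theorem hasFDerivAt_coupling (φ : Regularizer A) (q : stdSimplex ℝ A) (y : A → ℝ) :
    HasFDerivAt (φ.coupling q) (∑ a, ((φ.choice y : A → ℝ) a - (q : A → ℝ) a) •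
      (ContinuousLinearMap.proj a : (A → ℝ) →L[ℝ] ℝ)) y := by
  rw [hasFDerivAt_iff_isLittleO, Asymptotics.isLittleO_iff]
  intro ε hε
  have hcont : Tendsto (fun z => ‖(φ.choice z : A → ℝ) - φ.choice y‖) (𝓝 y) (𝓝 0) := by
    simpa using ((φ.continuous_coe_choice.tendsto y).sub_const (φ.choice y : A → ℝ)).norm
  have hpos : 0 < ε / (Fintype.card A : ℝ) := by
    have : 0 < Fintype.card A := Fintype.card_pos
    positivity
  filter_upwards [hcont.eventually_lt_const hpos] with z hz
  have e1 := φ.objective_sub_objective y z q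
  have e2 := φ.objective_sub_objective y z (φ.choice y)
  have e3 := φ.objective_sub_objective y z (φ.choice z)
  have h1 := φ.choice_spec z (φ.choice y)
  have h2 := φ.choice_spec y (φ.choice z)
  have hlin : (∑ a, ((φ.choice y : A → ℝ) a - (q : A → ℝ) a) •
      (ContinuousLinearMap.proj a : (A → ℝ) →L[ℝ] ℝ)) (z - y)
      = ∑ a, (φ.choice y : A → ℝ) a * (z a - y a) - ∑ a, (q : A → ℝ) a * (z a - y a) := by
    rw [sum_apply, ← Finset.sum_sub_distrib]
    refine Finset.sum_congr rfl fun a _ => ?_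
    simp only [smul_apply, ContinuousLinearMap.proj_apply, Pi.sub_apply,
      smul_eq_mul]
    ring
  have h3 : ∑ a, (φ.choice z : A → ℝ) a * (z a - y a)
      - ∑ a, (φ.choice y : A → ℝ) a * (z a - y a)
      = ∑ a, (⇑(φ.choice z) - ⇑(φ.choice y)) a * (z - y) a := by
    rw [← Finset.sum_sub_distrib]
    exact Finset.sum_congr rfl fun a _ => by simp only [Pi.sub_apply]; ring
  have h4 := abs_sum_mul_le (⇑(φ.choice z) - ⇑(φ.choice y)) (z - y)
  have h5 : Fintype.card A * (‖(φ.choice z : A → ℝ) - φ.choice y‖ * ‖z - y‖) ≤ ε * ‖z - y‖ := by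
    rw [← mul_assoc]
    gcongr
    have hA : (0 : ℝ) < Fintype.card A := by exact_mod_cast Fintype.card_pos
    have := (lt_div_iff₀ hA).1 hz
    linarith
  rw [hlin, Real.norm_eq_abs, abs_le]
  simp only [coupling]
  rw [← h3] at h4
  have h6 := (abs_le.1 (h4.trans h5)).2
  have h7 : 0 ≤ ε * ‖z - y‖ := by positivity
  constructor <;> linarith

/-- If `q` has full support, then the Fenchel coupling with `q` controls all score differences. -/
theorem exists_mul_sub_le_coupling (φ : Regularizer A) :
    ∃ K, ∀ (q : stdSimplex ℝ A) (y : A → ℝ) (a b : A),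
      (q : A → ℝ) a * (y b - y a) ≤ φ.coupling q y + K := by
  classical
  obtain ⟨K, hK⟩ := (isCompact_stdSimplex ℝ A).exists_bound_of_continuousOn φ.continuousOn
  refine ⟨2 * K, fun q y a b => ?_⟩
  obtain ⟨m, -, hm⟩ := Finset.exists_max_image Finset.univ y Finset.univ_nonempty
  have hm : ∀ c, y c ≤ y m := fun c => hm c (Finset.mem_univ c)
  have hq : ∑ c, (q : A → ℝ) c = 1 := q.2.2
  have hvertex := φ.choice_spec y ⟨_, single_mem_stdSimplex ℝ m⟩
  have e1 : φ.objective y (Pi.single m 1) = y m - φ.toFun (Pi.single m 1) := by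
    simp [objective, Pi.single_apply]
  have e2 : ∑ c, (q : A → ℝ) c * (y m - y c) = y m - ∑ c, y c * (q : A → ℝ) c := by
    simp only [mul_sub, Finset.sum_sub_distrib, ← Finset.sum_mul, hq, one_mul]
    congr 1
    exact Finset.sum_congr rfl fun c _ => mul_comm _ _
  have h1 : (q : A → ℝ) a * (y m - y a) ≤ ∑ c, (q : A → ℝ) c * (y m - y c) :=
    Finset.single_le_sum (f := fun c => (q : A → ℝ) c * (y m - y c))
      (fun c _ => mul_nonneg (q.2.1 c) (sub_nonneg.2 (hm c))) (Finset.mem_univ a)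
  have h2 : (q : A → ℝ) a * (y b - y a) ≤ (q : A → ℝ) a * (y m - y a) :=
    mul_le_mul_of_nonneg_left (sub_le_sub_right (hm b) _) (q.2.1 a)
  have h3 := hK _ (single_mem_stdSimplex ℝ m)
  have h4 : ‖φ.toFun q‖ ≤ K := hK _ q.2
  rw [Real.norm_eq_abs, abs_le] at h3 h4
  simp only [coupling]
  change φ.objective y (Pi.single m 1) ≤ _ at hvertex
  have e3 : φ.objective y q = ∑ c, y c * (q : A → ℝ) c - φ.toFun q := rfl
  linarith [h3.1, h3.2, h4.1, h4.2]

/-- The loss in objective of a strongly convex regularizer grows quadratically. -/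
theorem mul_norm_sq_le_coupling (φ : Regularizer A) {m : ℝ}
    (hm : StrongConvexOn (stdSimplex ℝ A) m φ.toFun) (q : stdSimplex ℝ A) (y : A → ℝ) :
    m / 4 * ‖(φ.choice y : A → ℝ) - q‖ ^ 2 ≤ φ.coupling q y := by
  have h1 : φ.toFun ((1 / 2 : ℝ) • ⇑(φ.choice y) + (1 / 2 : ℝ) • ⇑q)
      ≤ (1 / 2 : ℝ) • φ.toFun (φ.choice y) + (1 / 2 : ℝ) • φ.toFun q
        - 1 / 2 * (1 / 2) * (m / 2 * ‖⇑(φ.choice y) - ⇑q‖ ^ 2) :=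
    And.right hm (φ.choice y).2 q.2 (by norm_num) (by norm_num) (by norm_num)
  have hmid : (1 / 2 : ℝ) • (φ.choice y : A → ℝ) + (1 / 2 : ℝ) • (q : A → ℝ) ∈ stdSimplex ℝ A :=
    convex_stdSimplex ℝ A (φ.choice y).2 q.2 (by norm_num) (by norm_num) (by norm_num)
  have h2 : φ.objective y ((1 / 2 : ℝ) • ⇑(φ.choice y) + (1 / 2 : ℝ) • ⇑q) ≤
      φ.objective y (φ.choice y) := φ.choice_spec y ⟨_, hmid⟩
  have e : ∑ a, y a * ((1 / 2 : ℝ) • (φ.choice y : A → ℝ) + (1 / 2 : ℝ) • (q : A → ℝ)) a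
      = 1 / 2 * ∑ a, y a * (φ.choice y : A → ℝ) a + 1 / 2 * ∑ a, y a * (q : A → ℝ) a := by
    rw [Finset.mul_sum, Finset.mul_sum, ← Finset.sum_add_distrib]
    refine Finset.sum_congr rfl fun a _ => ?_
    simp only [Pi.add_apply, Pi.smul_apply, smul_eq_mul]
    ring
  simp only [coupling, objective] at h2 ⊢
  rw [e] at h2
  simp only [smul_eq_mul] at h1
  linarith

theorem exists_lipschitzWith_choice (φ : Regularizer A) {m : ℝ} (hm0 : 0 < m)
    (hm : StrongConvexOn (stdSimplex ℝ A) m φ.toFun) :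
    ∃ K, LipschitzWith K φ.choice := by
  refine ⟨Real.toNNReal (2 * Fintype.card A / m), LipschitzWith.of_dist_le_mul fun y z => ?_⟩
  rw [Real.coe_toNNReal _ (by positivity), dist_eq_norm y z]
  have hdist : dist (φ.choice y) (φ.choice z) = ‖⇑(φ.choice y) - ⇑(φ.choice z)‖ :=
    dist_eq_norm (φ.choice y : A → ℝ) (φ.choice z : A → ℝ)
  rw [hdist]
  have h1 := φ.mul_norm_sq_le_coupling hm (φ.choice z) y
  have h2 := φ.mul_norm_sq_le_coupling hm (φ.choice y) z
  rw [norm_sub_rev] at h2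
  have e1 := φ.objective_sub_objective z y (φ.choice y)
  have e2 := φ.objective_sub_objective z y (φ.choice z)
  have e3 : ∑ a, (φ.choice y : A → ℝ) a * (y a - z a)
      - ∑ a, (φ.choice z : A → ℝ) a * (y a - z a)
      = ∑ a, (⇑(φ.choice y) - ⇑(φ.choice z)) a * (y - z) a := by
    rw [← Finset.sum_sub_distrib]
    exact Finset.sum_congr rfl fun a _ => by simp only [Pi.sub_apply]; ring
  have h3 := (le_abs_self _).trans (abs_sum_mul_le (⇑(φ.choice y) - ⇑(φ.choice z)) (y - z))
  simp only [coupling] at h1 h2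
  set d := ‖(φ.choice y : A → ℝ) - φ.choice z‖
  have hd : 0 ≤ d := norm_nonneg _
  have h4 : d * (m / 2 * d) ≤ d * (Fintype.card A * ‖y - z‖) := by nlinarith
  rcases hd.eq_or_lt with h0 | h0
  · rw [← h0]; positivity
  · have h5 := le_of_mul_le_mul_left h4 h0
    rw [div_mul_eq_mul_div, le_div_iff₀ hm0]
    linarith

end Regularizer

/-! ### Sequential games: counterfactual values -/

namespace SeqGame

variable {N : ℕ} {A X : Type*} [Fintype A] (G : SeqGame N A X)

/-- Induction along the game tree, from the terminal histories backwards. -/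
theorem backward_induction {p : List A → Prop} (hterm : ∀ h, h ∉ G.nonterminal → p h)
    (hstep : ∀ h ∈ G.nonterminal, (∀ a, p (a :: h)) → p h) (h : List A) : p h := by
  by_cases hh : h ∈ G.nonterminal
  · exact hstep h hh fun a => backward_induction hterm hstep (a :: h)
  · exact hterm h hh
termination_by G.depth - h.length
decreasing_by
  have := G.length_lt_depth hh
  simp only [List.length_cons]
  omega

theorem value_of_mem (π : G.Policy) (i : Fin N) {h : List A} (hh : h ∈ G.nonterminal) :
    G.value π i h = ∑ a, G.act π h a * G.qHist π i h a := by
  rw [value, dif_pos hh]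
  rfl

theorem value_of_notMem (π : G.Policy) (i : Fin N) {h : List A} (hh : h ∉ G.nonterminal) :
    G.value π i h = 0 := by
  rw [value, dif_neg hh]

theorem mem_infoSet {x : X} {h : List A} :
    h ∈ G.infoSet x ↔ h ∈ G.nonterminal ∧ G.info h = some x := by
  simp [infoSet]

theorem act_of_info_eq_some (π : G.Policy) {h : List A} {x : X} (hx : G.info h = some x) (a : A) :
    G.act π h a = (π x : A → ℝ) a := by
  simp [act, hx]

theorem act_nonneg (π : G.Policy) {h : List A} (hh : h ∈ G.nonterminal) (a : A) :
    0 ≤ G.act π h a := by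
  rcases hx : G.info h with _ | x
  · simpa [act, hx] using G.chance_nonneg h hh hx a
  · simp [act, hx]

theorem oppReach_nonneg (π : G.Policy) (i : Fin N) {h : List A} (hh : h ∈ G.nonterminal) :
    0 ≤ G.oppReach π i h := by
  induction h with
  | nil => exact zero_le_one
  | cons a h ih =>
    have hh' := G.prefix_mem h a hh
    refine mul_nonneg (ih hh') ?_
    split_ifs
    · exact zero_le_one
    · exact G.act_nonneg π hh' a

/-- The counterfactual value `ρ^{π⁻ⁱ}(x) Qⁱ_π(x, a)`, without a division by the reach probability. -/
noncomputable def counterfactualValue (π : G.Policy) (x : X) (a : A) : ℝ :=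
  ∑ h ∈ G.infoSet x, G.oppReach π (G.player x) h * G.qHist π (G.player x) h a

/-- If the reach probability of `x` vanishes, then so does each term of the counterfactual value,
in agreement with the junk value of the division in `qInfo`. -/
theorem oppReachInfo_mul_qInfo (π : G.Policy) (x : X) (a : A) :
    G.oppReachInfo π x * G.qInfo π x a = G.counterfactualValue π x a := by
  rw [oppReachInfo, qInfo, counterfactualValue]
  by_cases h0 : ∑ h ∈ G.infoSet x, G.oppReach π (G.player x) h = 0
  · rw [h0, zero_mul]
    have := (Finset.sum_eq_zero_iff_of_nonneg fun h hh =>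
      G.oppReach_nonneg π (G.player x) (G.mem_infoSet.1 hh).1).1 h0
    exact (Finset.sum_eq_zero fun h hh => by rw [this h hh, zero_mul]).symm
  · exact mul_div_cancel₀ _ h0

/-! ### Counterfactual values do not depend on the policy at the information state -/

theorem value_congr {π π' : G.Policy} {i : Fin N} (h : List A)
    (hπ : ∀ h' ∈ G.nonterminal, h <:+ h' → ∀ x, G.info h' = some x → π x = π' x) :
    G.value π i h = G.value π' i h := by
  revert hπ
  refine G.backward_induction (p := fun h => (∀ h' ∈ G.nonterminal, h <:+ h' →
    ∀ x, G.info h' = some x → π x = π' x) → G.value π i h = G.value π' i h) ?_ ?_ h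
  · intro h hh _
    rw [G.value_of_notMem _ _ hh, G.value_of_notMem _ _ hh]
  · intro h hh ih hπ
    rw [G.value_of_mem _ _ hh, G.value_of_mem _ _ hh]
    refine Finset.sum_congr rfl fun a _ => ?_
    have h1 : G.act π h a = G.act π' h a := by
      rcases hx : G.info h with _ | x
      · simp [act, hx]
      · rw [G.act_of_info_eq_some π hx, G.act_of_info_eq_some π' hx,
          hπ h hh (List.suffix_refl h) x hx]
    rw [h1, qHist, qHist,
      ih a fun h' hh' hs => hπ h' hh' ((List.suffix_cons a h).trans hs)]

theorem length_ownSequence_le_of_suffix (i : Fin N) {h h' : List A} (hs : h <:+ h') :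
    (G.ownSequence i h).length ≤ (G.ownSequence i h').length := by
  obtain ⟨t, rfl⟩ := hs
  induction t with
  | nil => exact le_rfl
  | cons a t ih =>
    refine ih.trans ?_
    rw [List.cons_append, ownSequence]
    split
    · exact le_rfl
    · split_ifs
      · exact Nat.le_succ _
      · exact le_rfl

theorem ownSequence_cons_of_info {x : X} {h : List A} (hx : G.info h = some x) (a : A) :
    G.ownSequence (G.player x) (a :: h) = (x, a) :: G.ownSequence (G.player x) h := by
  simp [ownSequence, hx]

/-- With perfect recall no information state is visited twice, because the recorded own sequence
grows at each visit. -/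
theorem not_suffix_of_mem_infoSet (hrecall : G.PerfectRecall) {x : X} {h h' : List A} {a : A}
    (hh : h ∈ G.infoSet x) (hh' : h' ∈ G.infoSet x) : ¬ (a :: h) <:+ h' := by
  intro hs
  have h1 := G.length_ownSequence_le_of_suffix (G.player x) hs
  rw [G.ownSequence_cons_of_info (G.mem_infoSet.1 hh).2, ← hrecall x h hh h' hh',
    List.length_cons] at h1
  omega

theorem oppReach_congr {π π' : G.Policy} {i : Fin N} (hπ : ∀ x, G.player x ≠ i → π x = π' x)
    (h : List A) : G.oppReach π i h = G.oppReach π' i h := by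
  induction h with
  | nil => rfl
  | cons a h ih =>
    rw [oppReach, oppReach, ih]
    split_ifs with ht
    · rfl
    · congr 1
      rcases hx : G.info h with _ | x
      · simp [act, hx]
      · have hi : G.player x ≠ i := fun hi => ht (by simp [turn, hx, hi])
        rw [G.act_of_info_eq_some π hx, G.act_of_info_eq_some π' hx, hπ x hi]

theorem counterfactualValue_congr (hrecall : G.PerfectRecall) {π π' : G.Policy} {x : X}
    (hπ : ∀ x', x' ≠ x → π x' = π' x') (a : A) :
    G.counterfactualValue π x a = G.counterfactualValue π' x a := by
  refine Finset.sum_congr rfl fun h hh => ?_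
  rw [G.oppReach_congr (π' := π') fun x' hx' => hπ x' fun e => hx' (e ▸ rfl), qHist, qHist,
    G.value_congr (π' := π') (a :: h) fun h' hh' hs x' hx' => hπ x' ?_]
  rintro rfl
  exact G.not_suffix_of_mem_infoSet hrecall hh (G.mem_infoSet.2 ⟨hh', hx'⟩) hs

/-! ### The performance difference formula -/

/-- The probability that a history is reached. -/
def reach (G : SeqGame N A X) (π : G.Policy) : List A → ℝ
  | [] => 1
  | a :: h => G.reach π h * G.act π h a

/-- The probability of the actions of player `i` in a list of own information states and actions. -/
noncomputable def ownReach (μ : G.Policy) (l : List (X × A)) : ℝ :=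
  (l.map fun z => (μ z.1 : A → ℝ) z.2).prod

/-- The difference of the values of two policies, by telescoping over the game tree: the value
differences at the children of a history are counted once as children and once as histories, and
only the root remains. -/
theorem value_sub_value (D π : G.Policy) (i : Fin N) :
    G.value D i [] - G.value π i [] = ∑ h ∈ G.nonterminal, G.reach D h *
      ∑ a, (G.act D h a - G.act π h a) * G.qHist π i h a := by
  classical
  set e : List A → ℝ := fun h => G.value D i h - G.value π i h with he
  have he0 : ∀ h, h ∉ G.nonterminal → e h = 0 := fun h hh => by
    simp only [he]
    rw [G.value_of_notMem _ _ hh, G.value_of_notMem _ _ hh, sub_zero]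
  have hstep : ∀ h ∈ G.nonterminal, ∑ a, (G.act D h a - G.act π h a) * G.qHist π i h a
      = e h - ∑ a, G.act D h a * e (a :: h) := fun h hh => by
    simp only [he]
    rw [G.value_of_mem _ _ hh, G.value_of_mem _ _ hh, ← Finset.sum_sub_distrib,
      ← Finset.sum_sub_distrib]
    refine Finset.sum_congr rfl fun a _ => ?_
    simp only [qHist]
    ring
  have hsum : ∑ h ∈ G.nonterminal, ∑ a, G.reach D (a :: h) * e (a :: h)
      = ∑ h ∈ G.nonterminal.erase [], G.reach D h * e h := by
    rw [← Finset.sum_product']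
    have hinj : Set.InjOn (fun z : List A × A => z.2 :: z.1)
        (G.nonterminal ×ˢ (Finset.univ : Finset A) : Finset (List A × A)) := by
      rintro ⟨h, a⟩ _ ⟨h', a'⟩ _ heq
      simp only [List.cons.injEq] at heq
      exact Prod.ext heq.2 heq.1
    rw [← Finset.sum_image (f := fun h => G.reach D h * e h) hinj]
    symm
    refine Finset.sum_subset ?_ ?_
    · intro h hh
      rw [Finset.mem_erase] at hh
      rcases h with _ | ⟨a, h⟩
      · exact absurd rfl hh.1
      · exact Finset.mem_image.2 ⟨(h, a), by simp [G.prefix_mem h a hh.2], rfl⟩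
    · intro h hh hn
      obtain ⟨z, -, rfl⟩ := Finset.mem_image.1 hh
      have : z.2 :: z.1 ∉ G.nonterminal := fun hmem =>
        hn (Finset.mem_erase.2 ⟨List.cons_ne_nil _ _, hmem⟩)
      rw [he0 _ this, mul_zero]
  have hroot : e [] = ∑ h ∈ G.nonterminal, G.reach D h * e h
      - ∑ h ∈ G.nonterminal.erase [], G.reach D h * e h := by
    by_cases hnil : [] ∈ G.nonterminal
    · rw [← Finset.add_sum_erase _ _ hnil, reach, one_mul, add_sub_cancel_right]
    · rw [Finset.erase_eq_of_notMem hnil, sub_self, he0 _ hnil]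
  change e [] = _
  clear_value e
  rw [hroot, ← hsum, ← Finset.sum_sub_distrib]
  refine Finset.sum_congr rfl fun h hh => ?_
  rw [hstep h hh, mul_sub, Finset.mul_sum]
  congr 1
  exact Finset.sum_congr rfl fun a _ => by rw [reach, mul_assoc]

theorem reach_deviate (μ π : G.Policy) (i : Fin N) (h : List A) :
    G.reach (G.deviate i μ π) h = G.ownReach μ (G.ownSequence i h) * G.oppReach π i h := by
  induction h with
  | nil => simp [reach, ownReach, ownSequence, oppReach]
  | cons a h ih =>
    rw [reach, ih, oppReach, ownSequence]
    rcases hx : G.info h with _ | x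
    · simp only [turn, hx, Option.map_none, act, reduceCtorEq, if_false]
      ring
    · by_cases hi : G.player x = i
      · simp only [turn, hx, Option.map_some, act, deviate, hi, if_true, ownReach, List.map_cons,
          List.prod_cons]
        ring
      · have hi' : ¬ some (G.player x) = some i := fun e => hi (Option.some_injective _ e)
        simp only [turn, hx, Option.map_some, act, deviate, hi, if_false, hi']
        ring

/-- With perfect recall the own reach probability is a function of the information state. States
that no history visits get the weight `1`, which makes all weights positive. -/
theorem exists_ownReach_eq (hrecall : G.PerfectRecall) {μ : G.Policy} (hμ : G.IsInterior μ) :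
    ∃ κ : X → ℝ, (∀ x, 0 < κ x) ∧
      ∀ x, ∀ h ∈ G.infoSet x, G.ownReach μ (G.ownSequence (G.player x) h) = κ x := by
  have hpos : ∀ l, 0 < G.ownReach μ l := fun l => by
    refine List.prod_pos fun z hz => ?_
    obtain ⟨y, -, rfl⟩ := List.mem_map.1 hz
    exact hμ y.1 y.2
  have : ∀ x, ∃ k : ℝ, 0 < k ∧
      ∀ h ∈ G.infoSet x, G.ownReach μ (G.ownSequence (G.player x) h) = k := fun x => by
    rcases (G.infoSet x).eq_empty_or_nonempty with h0 | ⟨h, hh⟩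
    · exact ⟨1, one_pos, by simp [h0]⟩
    · exact ⟨_, hpos _, fun h' hh' => by rw [hrecall x h' hh' h hh]⟩
  choose κ hκ using this
  exact ⟨κ, fun x => (hκ x).1, fun x => (hκ x).2⟩

/-- Performance difference formula: the gain of all players from unilateral deviations to `μ`,
in terms of the counterfactual values. -/
theorem sum_value_deviate_sub_value [Fintype X] {μ : G.Policy} {κ : X → ℝ}
    (hκ : ∀ x, ∀ h ∈ G.infoSet x, G.ownReach μ (G.ownSequence (G.player x) h) = κ x)
    (π : G.Policy) :
    ∑ i, (G.value (G.deviate i μ π) i [] - G.value π i []) =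
      ∑ x, κ x * ∑ a, ((μ x : A → ℝ) a - (π x : A → ℝ) a) * G.counterfactualValue π x a := by
  classical
  have hplayer : ∀ i, G.value (G.deviate i μ π) i [] - G.value π i [] =
      ∑ x, if G.player x = i then
        κ x * ∑ a, ((μ x : A → ℝ) a - (π x : A → ℝ) a) * G.counterfactualValue π x a
      else 0 := by
    intro i
    have hdiff : ∀ h, ∑ a, (G.act (G.deviate i μ π) h a - G.act π h a) * G.qHist π i h a
        = ∑ x, if G.info h = some x ∧ G.player x = i then
            ∑ a, ((μ x : A → ℝ) a - (π x : A → ℝ) a) * G.qHist π i h a else 0 := by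
      intro h
      rcases hx : G.info h with _ | x
      · simp [act, hx]
      · rw [Finset.sum_eq_single x (fun y _ hy => if_neg fun e => hy
          (Option.some_injective _ e.1).symm) (by simp)]
        by_cases hi : G.player x = i
        · simp [act, hx, deviate, hi]
        · simp [act, hx, deviate, hi]
    rw [value_sub_value]
    simp only [hdiff, Finset.mul_sum]
    rw [Finset.sum_comm]
    refine Finset.sum_congr rfl fun x _ => ?_
    by_cases hi : G.player x = i
    · subst hi
      simp only [and_true, if_true]
      have : ∀ h, G.reach (G.deviate (G.player x) μ π) h *
          (if G.info h = some x then
            ∑ a, ((μ x : A → ℝ) a - (π x : A → ℝ) a) * G.qHist π (G.player x) h a else 0)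
          = if G.info h = some x then G.reach (G.deviate (G.player x) μ π) h *
            ∑ a, ((μ x : A → ℝ) a - (π x : A → ℝ) a) * G.qHist π (G.player x) h a else 0 :=
        fun h => by rw [mul_ite, mul_zero]
      simp only [this]
      rw [← Finset.sum_filter]
      simp only [counterfactualValue, Finset.mul_sum]
      rw [Finset.sum_comm]
      refine Finset.sum_congr rfl fun a _ => ?_
      rw [show G.nonterminal.filter (fun h => G.info h = some x) = G.infoSet x by
        rw [infoSet]]
      refine Finset.sum_congr rfl fun h hh => ?_
      rw [reach_deviate, hκ x h hh]
      ring
    · simp [hi]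
  simp only [hplayer]
  rw [Finset.sum_comm]
  refine Finset.sum_congr rfl fun x _ => ?_
  simp

/-! ### Regularity of the counterfactual values -/

theorem exists_lipschitzWith_mul {P : Type*} [PseudoMetricSpace P] [CompactSpace P] {f g : P → ℝ}
    (hf : ∃ K, LipschitzWith K f) (hg : ∃ K, LipschitzWith K g) :
    ∃ K, LipschitzWith K fun p => f p * g p := by
  obtain ⟨K, hK⟩ := hf
  obtain ⟨L, hL⟩ := hg
  obtain ⟨M, hM⟩ := isCompact_univ.exists_bound_of_continuousOn hK.continuous.continuousOn
  obtain ⟨M', hM'⟩ := isCompact_univ.exists_bound_of_continuousOn hL.continuous.continuousOn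
  refine ⟨Real.toNNReal (M * L + K * M'), LipschitzWith.of_dist_le' fun p q => ?_⟩
  have h1 := hK.dist_le_mul p q
  have h2 := hL.dist_le_mul p q
  have h3 := hM p trivial
  have h4 := hM' q trivial
  rw [dist_eq_norm] at h1 h2 ⊢
  have hM0 : 0 ≤ M := (norm_nonneg _).trans h3
  calc ‖f p * g p - f q * g q‖ = ‖f p * (g p - g q) + (f p - f q) * g q‖ := by congr 1; ring
    _ ≤ ‖f p‖ * ‖g p - g q‖ + ‖f p - f q‖ * ‖g q‖ :=
        (norm_add_le _ _).trans_eq (by rw [norm_mul, norm_mul])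
    _ ≤ M * (L * dist p q) + (K * dist p q) * M' := by gcongr
    _ = (M * L + K * M') * dist p q := by ring

theorem exists_lipschitzWith_sum {P ι : Type*} [PseudoMetricSpace P] (s : Finset ι)
    {f : ι → P → ℝ} (hf : ∀ i ∈ s, ∃ K, LipschitzWith K (f i)) :
    ∃ K, LipschitzWith K fun p => ∑ i ∈ s, f i p := by
  classical
  induction s using Finset.induction_on with
  | empty => exact ⟨0, by simp⟩
  | insert i s hi ih =>
    obtain ⟨K, hK⟩ := hf i (Finset.mem_insert_self i s)
    obtain ⟨L, hL⟩ := ih fun j hj => hf j (Finset.mem_insert_of_mem hj)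
    exact ⟨K + L, by simpa [Finset.sum_insert hi] using hK.add hL⟩

section

variable [Fintype X]

instance : CompactSpace (stdSimplex ℝ A) :=
  isCompact_iff_compactSpace.1 (isCompact_stdSimplex ℝ A)

theorem exists_lipschitzWith_act (h : List A) (a : A) :
    ∃ K, LipschitzWith K fun π : G.Policy => G.act π h a := by
  rcases hx : G.info h with _ | x
  · exact ⟨0, by simp [act, hx]⟩
  · refine ⟨1, LipschitzWith.of_dist_le_mul fun π π' => ?_⟩
    rw [G.act_of_info_eq_some π hx, G.act_of_info_eq_some π' hx, NNReal.coe_one, one_mul]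
    exact (dist_le_pi_dist (π x : A → ℝ) (π' x : A → ℝ) a).trans (dist_le_pi_dist π π' x)

theorem exists_lipschitzWith_value (i : Fin N) (h : List A) :
    ∃ K, LipschitzWith K fun π : G.Policy => G.value π i h := by
  refine G.backward_induction
    (p := fun h => ∃ K, LipschitzWith K fun π : G.Policy => G.value π i h) ?_ ?_ h
  · intro h hh
    exact ⟨0, by simp [G.value_of_notMem _ _ hh]⟩
  · intro h hh ih
    simp only [G.value_of_mem _ _ hh]
    refine exists_lipschitzWith_sum _ fun a _ =>
      exists_lipschitzWith_mul (G.exists_lipschitzWith_act h a) ?_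
    obtain ⟨K, hK⟩ := ih a
    exact ⟨0 + K, (LipschitzWith.const (G.reward i h a)).add hK⟩

theorem exists_lipschitzWith_oppReach (i : Fin N) (h : List A) :
    ∃ K, LipschitzWith K fun π : G.Policy => G.oppReach π i h := by
  induction h with
  | nil => exact ⟨0, LipschitzWith.const _⟩
  | cons a h ih =>
    refine exists_lipschitzWith_mul ih ?_
    by_cases ht : G.turn h = some i
    · exact ⟨0, by simp [ht]⟩
    · simpa [ht] using G.exists_lipschitzWith_act h a

theorem exists_lipschitzWith_counterfactualValue :
    ∃ K, LipschitzWith K fun π : G.Policy => G.counterfactualValue π := by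
  have hxa : ∀ x a, ∃ K, LipschitzWith K fun π : G.Policy => G.counterfactualValue π x a := by
    intro x a
    refine exists_lipschitzWith_sum _ fun h _ =>
      exists_lipschitzWith_mul (G.exists_lipschitzWith_oppReach _ h) ?_
    obtain ⟨K, hK⟩ := G.exists_lipschitzWith_value (G.player x) (a :: h)
    exact ⟨0 + K, (LipschitzWith.const (G.reward (G.player x) h a)).add hK⟩
  choose K hK using hxa
  refine ⟨Finset.univ.sup fun x => Finset.univ.sup fun a => K x a,
    LipschitzWith.of_dist_le_mul fun π π' => ?_⟩
  refine (dist_pi_le_iff (by positivity)).2 fun x => (dist_pi_le_iff (by positivity)).2 fun a => ?_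
  refine ((hK x a).dist_le_mul π π').trans ?_
  gcongr
  exact (Finset.le_sup (f := K x) (Finset.mem_univ a)).trans
    (Finset.le_sup (f := fun x => Finset.univ.sup fun a => K x a) (Finset.mem_univ x))

end

end SeqGame

/-! ### The reduced dynamics -/

theorem eq_of_hasDerivWithinAt_zero {E : Type*} [NormedAddCommGroup E] [NormedSpace ℝ E]
    {f : ℝ → E} (hf : ∀ t, 0 ≤ t → HasDerivWithinAt f 0 (Set.Ici 0) t) {t : ℝ} (ht : 0 ≤ t) :
    f t = f 0 :=
  constant_of_has_deriv_right_zero (a := 0) (b := t)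
    (fun s hs => ((hf s hs.1).mono fun _ h => h.1).continuousWithinAt)
    (fun s hs => (hf s hs.1).mono (Set.Ici_subset_Ici.2 hs.1)) t ⟨ht, le_rfl⟩

theorem continuous_reduceScores {A X : Type*} (a₀ : X → A) : Continuous (reduceScores a₀) :=
  continuous_pi fun x => continuous_pi fun a => by
    unfold reduceScores
    fun_prop

theorem hasDerivWithinAt_reduceScores {A X : Type*} [Fintype A] [Fintype X] (a₀ : X → A)
    {y : ℝ → X → A → ℝ} {y' : X → A → ℝ} {s : Set ℝ}
    {t : ℝ} (h : HasDerivWithinAt y y' s t) :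
    HasDerivWithinAt (fun t => reduceScores a₀ (y t)) (reduceScores a₀ y') s t := by
  have hxa : ∀ x a, HasDerivWithinAt (fun t => y t x a) (y' x a) s t := fun x a =>
    hasDerivWithinAt_pi.1 (hasDerivWithinAt_pi.1 h x) a
  exact hasDerivWithinAt_pi.2 fun x => hasDerivWithinAt_pi.2 fun a =>
    (hxa x a).sub (hxa x (a₀ x))

namespace SeqGame

section

variable {N : ℕ} {A X : Type*} [Fintype A] [Fintype X] (G : SeqGame N A X)

theorem continuous_counterfactualValue :
    Continuous fun π : G.Policy => G.counterfactualValue π :=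
  G.exists_lipschitzWith_counterfactualValue.choose_spec.continuous

/-- The weighted gain from switching from `π` to `πs` at single information states. -/
noncomputable def totalGain (κ : X → ℝ) (πs π : G.Policy) : ℝ :=
  ∑ x, κ x * ∑ a, ((πs x : A → ℝ) a - (π x : A → ℝ) a) * G.counterfactualValue π x a

/-- By monotonicity the total gain from unilateral deviations to the equilibrium is at least the
total loss from unilateral deviations from it. -/
theorem totalGain_nonneg (hmono : G.IsMonotone) {πs : G.Policy} (hnash : G.IsNash πs)
    {κ : X → ℝ} (hκ : ∀ x, ∀ h ∈ G.infoSet x, G.ownReach πs (G.ownSequence (G.player x) h) = κ x)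
    (π : G.Policy) : 0 ≤ G.totalGain κ πs π := by
  rw [totalGain, ← G.sum_value_deviate_sub_value hκ π]
  by_cases hπ : π = πs
  · subst hπ
    refine Finset.sum_nonneg fun i _ => ?_
    have : G.deviate i π π = π := funext fun x => by simp [deviate]
    rw [this, sub_self]
  · have h1 := hmono π πs hπ
    have h2 : ∑ i, (G.value (G.deviate i π πs) i [] - G.value πs i []) ≤ 0 :=
      Finset.sum_nonpos fun i _ => sub_nonpos.2 (hnash i π)
    have h3 : ∑ i, G.omega i π πs = - ∑ i, (G.value (G.deviate i πs π) i [] - G.value π i [])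
        - ∑ i, (G.value (G.deviate i π πs) i [] - G.value πs i []) := by
      rw [← Finset.sum_neg_distrib, ← Finset.sum_sub_distrib]
      exact Finset.sum_congr rfl fun i _ => by rw [omega]; ring
    linarith

theorem continuous_totalGain (κ : X → ℝ) (πs : G.Policy) : Continuous (G.totalGain κ πs) := by
  refine continuous_finsetSum _ fun x _ => continuous_const.mul
    (continuous_finsetSum _ fun a _ => (continuous_const.sub ?_).mul ?_)
  · exact (continuous_apply a).comp (continuous_subtype_val.comp (continuous_apply x))
  · exact (continuous_apply a).comp ((continuous_apply x).comp G.continuous_counterfactualValue)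

end

variable {N : ℕ} {A X : Type*} [Fintype A] [Nonempty A] (G : SeqGame N A X)
  (φ : Fin N → Regularizer A) (a₀ : X → A)

theorem reducedField_eq (w : X → A → ℝ) :
    G.reducedField φ a₀ w = reduceScores a₀ (G.counterfactualValue (G.policyOf φ w)) := by
  funext x a
  rw [reducedField, reduceScores, mul_sub, oppReachInfo_mul_qInfo, oppReachInfo_mul_qInfo]

theorem policyOf_reduceScores (y : X → A → ℝ) :
    G.policyOf φ (reduceScores a₀ y) = G.policyOf φ y :=
  funext fun x => (φ (G.player x)).choice_sub_const (y x) (y x (a₀ x))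

theorem reducedField_apply_eq_of_eq_off (hrecall : G.PerfectRecall) {w w' : X → A → ℝ} {x : X}
    (h : ∀ x', x' ≠ x → w' x' = w x') : G.reducedField φ a₀ w' x = G.reducedField φ a₀ w x := by
  have hπ : ∀ x', x' ≠ x → G.policyOf φ w' x' = G.policyOf φ w x' := fun x' hx' => by
    rw [policyOf, policyOf, h x' hx']
  funext a
  simp only [reducedField_eq, reduceScores]
  rw [G.counterfactualValue_congr hrecall hπ, G.counterfactualValue_congr hrecall hπ]

theorem divergenceFree_reducedField [Fintype X] (hrecall : G.PerfectRecall) :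
    DivergenceFree (G.reducedField φ a₀) := by
  classical
  intro w
  constructor
  · intro x a
    refine (differentiableAt_const (G.reducedField φ a₀ w x a)).congr_of_eventuallyEq
      (Eventually.of_forall fun s => congrFun
        (G.reducedField_apply_eq_of_eq_off φ a₀ hrecall fun x' hx' => ?_) a)
    rw [Function.update_of_ne hx']
  · refine Finset.sum_eq_zero fun x _ => Finset.sum_eq_zero fun a _ => ?_
    refine (EventuallyEq.deriv_eq (f := fun _ => G.reducedField φ a₀ w x a)
      (Eventually.of_forall fun s => congrFun
        (G.reducedField_apply_eq_of_eq_off φ a₀ hrecall fun x' hx' => ?_) a)).trans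
      (deriv_const _ _)
    rw [Function.update_of_ne hx']

theorem continuous_policyOf : Continuous (G.policyOf φ) :=
  continuous_pi fun x => (φ (G.player x)).continuous_choice.comp (continuous_apply x)

section

variable [Fintype X]

theorem continuous_reducedField : Continuous (G.reducedField φ a₀) := by
  rw [funext (G.reducedField_eq φ a₀)]
  exact (continuous_reduceScores a₀).comp
    (G.continuous_counterfactualValue.comp (G.continuous_policyOf φ))

theorem exists_norm_reducedField_le : ∃ C, ∀ w, ‖G.reducedField φ a₀ w‖ ≤ C := by
  obtain ⟨C, hC⟩ := isCompact_univ.exists_bound_of_continuousOn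
    ((continuous_reduceScores a₀).comp G.continuous_counterfactualValue).continuousOn
  exact ⟨C, fun w => by rw [reducedField_eq]; exact hC (G.policyOf φ w) trivial⟩

theorem isFoReL_iff {y : ℝ → X → A → ℝ} : G.IsFoReL φ y ↔
    IsSolution (fun z => G.counterfactualValue (G.policyOf φ z)) y := by
  simp only [IsFoReL, IsSolution, oppReachInfo_mul_qInfo]

theorem isReduced_reduceScores {y : ℝ → X → A → ℝ} (hy : G.IsFoReL φ y) :
    G.IsReduced φ a₀ fun t => reduceScores a₀ (y t) := by
  intro t ht
  have h := hasDerivWithinAt_reduceScores a₀ ((G.isFoReL_iff φ).1 hy t ht)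
  rwa [reducedField_eq, policyOf_reduceScores]

/-- The scores of the reference actions are constants of motion of the reduced dynamics. -/
theorem apply_reference_eq {w : ℝ → X → A → ℝ} (hw : G.IsReduced φ a₀ w) {t : ℝ} (ht : 0 ≤ t)
    (x : X) : w t x (a₀ x) = w 0 x (a₀ x) := by
  refine eq_of_hasDerivWithinAt_zero (f := fun t => w t x (a₀ x)) (fun s hs => ?_) ht
  have h := hasDerivWithinAt_pi.1 (hasDerivWithinAt_pi.1 (hw s hs) x) (a₀ x)
  rwa [reducedField_eq, reduceScores, sub_self] at h

/-- A solution of the reduced dynamics determines the policies, hence by integration the FoReL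
scores. -/
theorem exists_isFoReL_of_isReduced {w : ℝ → X → A → ℝ} (hw : G.IsReduced φ a₀ w)
    {y₀ : X → A → ℝ} (h₀ : reduceScores a₀ y₀ = reduceScores a₀ (w 0)) :
    ∃ y, G.IsFoReL φ y ∧ y 0 = y₀ ∧
      ∀ t, 0 ≤ t → reduceScores a₀ (y t) = reduceScores a₀ (w t) := by
  set g : ℝ → X → A → ℝ := fun s => G.counterfactualValue (G.policyOf φ (w (max s 0))) with hg
  have hwcont : Continuous fun s : ℝ => w (max s 0) := by
    have h1 : ContinuousOn w (Set.Ici 0) := fun t ht => (hw t ht).continuousWithinAt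
    exact h1.comp_continuous (continuous_id.max continuous_const) fun s => le_max_right s 0
  have hgcont : Continuous g :=
    G.continuous_counterfactualValue.comp ((G.continuous_policyOf φ).comp hwcont)
  set y : ℝ → X → A → ℝ := fun t => y₀ + ∫ s in (0 : ℝ)..t, g s with hy
  have hder : ∀ t, HasDerivAt y (g t) t := fun t =>
    (intervalIntegral.integral_hasDerivAt_right (hgcont.intervalIntegrable _ _)
      hgcont.stronglyMeasurable.stronglyMeasurableAtFilter hgcont.continuousAt).const_add y₀
  have hg0 : ∀ t, 0 ≤ t → g t = G.counterfactualValue (G.policyOf φ (w t)) := fun t ht => by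
    simp only [hg, max_eq_left ht]
  have hy0 : y 0 = y₀ := by simp [hy]
  have hred : ∀ t, 0 ≤ t → reduceScores a₀ (y t) = reduceScores a₀ (w t) := by
    intro t ht
    have h := eq_of_hasDerivWithinAt_zero
      (f := fun t => reduceScores a₀ (y t) - reduceScores a₀ (w t)) (fun s hs => ?_) ht
    · simp only [hy0, h₀, sub_self] at h
      exact sub_eq_zero.1 h
    · have h1 := hasDerivWithinAt_reduceScores a₀ ((hder s).hasDerivWithinAt (s := Set.Ici 0))
      have h2 := hasDerivWithinAt_reduceScores a₀ (hw s hs)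
      have h3 := h1.sub h2
      have e : reduceScores a₀ (g s) - reduceScores a₀ (G.reducedField φ a₀ (w s)) = 0 := by
        rw [hg0 s hs, reducedField_eq]
        funext x a
        simp [reduceScores]
      rwa [e] at h3
  refine ⟨y, (G.isFoReL_iff φ).2 fun t ht => ?_, hy0, hred⟩
  have h1 := (hder t).hasDerivWithinAt (s := Set.Ici 0)
  rwa [hg0 t ht, ← G.policyOf_reduceScores φ a₀ (w t), ← hred t ht,
    policyOf_reduceScores] at h1

/-! ### The Lyapunov function -/

/-- The Fenchel couplings of the scores with the policy `πs`, weighted over the information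
states by `κ`. -/
noncomputable def lyapunov (κ : X → ℝ) (πs : G.Policy) (w : X → A → ℝ) : ℝ :=
  ∑ x, κ x * (φ (G.player x)).coupling (πs x) (w x)

theorem continuous_lyapunov (κ : X → ℝ) (πs : G.Policy) : Continuous (G.lyapunov φ κ πs) :=
  continuous_finsetSum _ fun x _ => continuous_const.mul
    ((continuous_iff_continuousAt.2 fun y =>
      ((φ (G.player x)).hasFDerivAt_coupling (πs x) y).continuousAt).comp (continuous_apply x))

/-- The reference counterfactual values drop out of the derivative because both policies have total
mass one. -/
theorem hasDerivWithinAt_lyapunov (κ : X → ℝ) (πs : G.Policy) {w : ℝ → X → A → ℝ}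
    (hw : G.IsReduced φ a₀ w) {t : ℝ} (ht : 0 ≤ t) :
    HasDerivWithinAt (fun t => G.lyapunov φ κ πs (w t))
      (-G.totalGain κ πs (G.policyOf φ (w t))) (Set.Ici 0) t := by
  have hx : ∀ x, HasDerivWithinAt
      (fun t => κ x * (φ (G.player x)).coupling (πs x) (w t x))
      (κ x * (∑ a, ((G.policyOf φ (w t) x : A → ℝ) a - (πs x : A → ℝ) a) •
        (ContinuousLinearMap.proj a : (A → ℝ) →L[ℝ] ℝ)) (G.reducedField φ a₀ (w t) x))
      (Set.Ici 0) t := fun x => by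
    have h1 := ((φ (G.player x)).hasFDerivAt_coupling (πs x) (w t x)).comp_hasDerivWithinAt t
      (hasDerivWithinAt_pi.1 (hw t ht) x)
    exact h1.const_mul (κ x)
  have h := HasDerivWithinAt.fun_sum (u := Finset.univ) fun x _ => hx x
  refine h.congr_deriv ?_
  rw [totalGain, ← Finset.sum_neg_distrib]
  refine Finset.sum_congr rfl fun x _ => ?_
  rw [← mul_neg, ← Finset.sum_neg_distrib, sum_apply, reducedField_eq]
  congr 1
  set π := G.policyOf φ (w t)
  have hsum : ∑ a, ((π x : A → ℝ) a - (πs x : A → ℝ) a)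
      * G.counterfactualValue π x (a₀ x) = 0 := by
    rw [← Finset.sum_mul, Finset.sum_sub_distrib, stdSimplex.sum_eq_one, stdSimplex.sum_eq_one,
      sub_self, zero_mul]
  rw [← sub_eq_zero, ← neg_eq_zero, ← hsum, ← Finset.sum_sub_distrib, ← Finset.sum_neg_distrib]
  refine Finset.sum_congr rfl fun a _ => ?_
  simp only [smul_apply, ContinuousLinearMap.proj_apply, smul_eq_mul, reduceScores]
  change -(((π x : A → ℝ) a - (πs x : A → ℝ) a) * _ - _) = _
  ring

theorem antitoneOn_lyapunov (hmono : G.IsMonotone) {πs : G.Policy} (hnash : G.IsNash πs)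
    {κ : X → ℝ} (hκ : ∀ x, ∀ h ∈ G.infoSet x, G.ownReach πs (G.ownSequence (G.player x) h) = κ x)
    {w : ℝ → X → A → ℝ} (hw : G.IsReduced φ a₀ w) :
    AntitoneOn (fun t => G.lyapunov φ κ πs (w t)) (Set.Ici 0) :=
  antitoneOn_of_hasDerivWithinAt_nonpos (convex_Ici 0)
    (fun _ ht => (G.hasDerivWithinAt_lyapunov φ a₀ κ πs hw ht).continuousWithinAt)
    (fun _ ht => (G.hasDerivWithinAt_lyapunov φ a₀ κ πs hw (interior_subset ht)).mono
      interior_subset)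
    fun _ _ => neg_nonpos.2 (G.totalGain_nonneg hmono hnash hκ _)

/-- Bounds on the Lyapunov function and on the conserved scores of the reference actions. -/
def sublevel (κ : X → ℝ) (πs : G.Policy) (c : ℝ) : Set (X → A → ℝ) :=
  {w | G.lyapunov φ κ πs w ≤ c ∧ ∀ x, |w x (a₀ x)| ≤ c}

theorem isCompact_sublevel {κ : X → ℝ} (hκ0 : ∀ x, 0 < κ x) {πs : G.Policy}
    (hint : G.IsInterior πs) (c : ℝ) : IsCompact (G.sublevel φ a₀ κ πs c) := by
  refine Metric.isCompact_of_isClosed_isBounded ?_ ?_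
  · refine (isClosed_le (G.continuous_lyapunov φ κ πs) continuous_const).inter ?_
    change IsClosed {w : X → A → ℝ | ∀ x, |w x (a₀ x)| ≤ c}
    simp only [Set.ofPred_forall]
    exact isClosed_iInter fun x => isClosed_le (by fun_prop) continuous_const
  · rw [← Bornology.forall_isBounded_image_eval_iff]
    intro x
    rw [← Bornology.forall_isBounded_image_eval_iff]
    intro a
    obtain ⟨K, hK⟩ := (φ (G.player x)).exists_mul_sub_le_coupling
    rw [isBounded_iff_forall_norm_le]
    refine ⟨c + ((c / κ x + K) / (πs x : A → ℝ) a + (c / κ x + K) / (πs x : A → ℝ) (a₀ x)), ?_⟩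
    rintro _ ⟨_, ⟨w, hw, rfl⟩, rfl⟩
    change ‖w x a‖ ≤ _
    have hcoup : (φ (G.player x)).coupling (πs x) (w x) ≤ c / κ x := by
      rw [le_div_iff₀' (hκ0 x)]
      refine le_trans ?_ hw.1
      exact Finset.single_le_sum
        (f := fun x => κ x * (φ (G.player x)).coupling (πs x) (w x))
        (fun x _ => mul_nonneg (hκ0 x).le (Regularizer.coupling_nonneg _ _ _)) (Finset.mem_univ x)
    have h1 : w x (a₀ x) - w x a ≤ (c / κ x + K) / (πs x : A → ℝ) a := by
      rw [le_div_iff₀' (hint x a)]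
      exact (hK (πs x) (w x) a (a₀ x)).trans (by linarith)
    have h2 : w x a - w x (a₀ x) ≤ (c / κ x + K) / (πs x : A → ℝ) (a₀ x) := by
      rw [le_div_iff₀' (hint x (a₀ x))]
      exact (hK (πs x) (w x) (a₀ x) a).trans (by linarith)
    have h0 : 0 ≤ c / κ x + K := by
      have := hK (πs x) (w x) a a
      rw [sub_self, mul_zero] at this
      linarith
    have h3 : 0 ≤ (c / κ x + K) / (πs x : A → ℝ) a := div_nonneg h0 (hint x a).le
    have h4 : 0 ≤ (c / κ x + K) / (πs x : A → ℝ) (a₀ x) := div_nonneg h0 (hint x (a₀ x)).le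
    have h5 := abs_le.1 (hw.2 x)
    rw [Real.norm_eq_abs, abs_le]
    constructor <;> linarith [h5.1, h5.2]

theorem mem_sublevel_of_isReduced (hmono : G.IsMonotone) {πs : G.Policy} (hnash : G.IsNash πs)
    {κ : X → ℝ} (hκ : ∀ x, ∀ h ∈ G.infoSet x, G.ownReach πs (G.ownSequence (G.player x) h) = κ x)
    {w : ℝ → X → A → ℝ} (hw : G.IsReduced φ a₀ w) {c : ℝ}
    (h0 : w 0 ∈ G.sublevel φ a₀ κ πs c) {t : ℝ} (ht : 0 ≤ t) :
    w t ∈ G.sublevel φ a₀ κ πs c :=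
  ⟨(G.antitoneOn_lyapunov φ a₀ hmono hnash hκ hw Set.self_mem_Ici ht ht).trans h0.1,
    fun x => by rw [G.apply_reference_eq φ a₀ hw ht]; exact h0.2 x⟩

theorem exists_mem_sublevel (κ : X → ℝ) (πs : G.Policy) (w : X → A → ℝ) :
    ∃ n : ℕ, w ∈ G.sublevel φ a₀ κ πs n := by
  obtain ⟨n, hn⟩ := exists_nat_ge (max (G.lyapunov φ κ πs w) ‖w‖)
  exact ⟨n, (le_max_left _ _).trans hn, fun x =>
    ((norm_le_pi_norm (w x) (a₀ x)).trans (norm_le_pi_norm w x)).trans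
      ((le_max_right _ _).trans hn)⟩

end

end SeqGame

/-! ### Recurrence and non-convergence of the learning dynamics -/

theorem IsRecurrent.comp_continuous {E F : Type*} [TopologicalSpace E] [TopologicalSpace F]
    {w : ℝ → E} (hw : IsRecurrent w) {f : E → F} (hf : Continuous f) :
    IsRecurrent fun t => f (w t) := by
  obtain ⟨t, ht, hlim⟩ := hw
  exact ⟨t, ht, (hf.tendsto _).comp hlim⟩

theorem IsRecurrent.congr {E : Type*} [TopologicalSpace E] {w w' : ℝ → E} (hw : IsRecurrent w)
    (h : ∀ t, 0 ≤ t → w' t = w t) : IsRecurrent w' := by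
  obtain ⟨t, ht, hlim⟩ := hw
  refine ⟨t, ht, ?_⟩
  rw [h 0 le_rfl]
  exact hlim.congr' ((ht.eventually_ge_atTop 0).mono fun n hn => (h _ hn).symm)

/-- A continuous function that decreases along a path is constant along it if the path is
recurrent. -/
theorem IsRecurrent.eq_of_antitoneOn {E : Type*} [TopologicalSpace E] {w : ℝ → E}
    (hw : IsRecurrent w) {F : E → ℝ} (hF : Continuous F)
    (hanti : AntitoneOn (fun t => F (w t)) (Set.Ici 0)) {t : ℝ} (ht : 0 ≤ t) :
    F (w t) = F (w 0) := by
  refine le_antisymm (hanti Set.self_mem_Ici ht ht) ?_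
  obtain ⟨s, hs, hlim⟩ := hw
  exact le_of_tendsto ((hF.tendsto _).comp hlim) ((hs.eventually_ge_atTop t).mono fun n hn =>
    hanti ht (ht.trans hn) hn)

namespace SeqGame

variable {N : ℕ} {A X : Type*} [Fintype A] [Nonempty A] [Fintype X] (G : SeqGame N A X)
  (φ : Fin N → Regularizer A) (a₀ : X → A)

theorem exists_isReduced (w₀ : X → A → ℝ) : ∃ w, G.IsReduced φ a₀ w ∧ w 0 = w₀ := by
  obtain ⟨C, hC⟩ := G.exists_norm_reducedField_le φ a₀
  exact (isScheme_fullStep (G.continuous_reducedField φ a₀) hC).exists_isSolution_from w₀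

theorem isBounded_of_isReduced (hmono : G.IsMonotone) {πs : G.Policy} (hnash : G.IsNash πs)
    (hint : G.IsInterior πs) {κ : X → ℝ} (hκ0 : ∀ x, 0 < κ x)
    (hκ : ∀ x, ∀ h ∈ G.infoSet x, G.ownReach πs (G.ownSequence (G.player x) h) = κ x)
    {w : ℝ → X → A → ℝ} (hw : G.IsReduced φ a₀ w) : Bornology.IsBounded (w '' Set.Ici 0) := by
  obtain ⟨n, hn⟩ := G.exists_mem_sublevel φ a₀ κ πs (w 0)
  refine (G.isCompact_sublevel φ a₀ hκ0 hint n).isBounded.subset ?_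
  rintro _ ⟨t, ht, rfl⟩
  exact G.mem_sublevel_of_isReduced φ a₀ hmono hnash hκ hw hn ht

theorem ae_exists_isReduced_isRecurrent (hrecall : G.PerfectRecall) (hmono : G.IsMonotone)
    {πs : G.Policy} (hnash : G.IsNash πs) (hint : G.IsInterior πs) {κ : X → ℝ}
    (hκ0 : ∀ x, 0 < κ x)
    (hκ : ∀ x, ∀ h ∈ G.infoSet x, G.ownReach πs (G.ownSequence (G.player x) h) = κ x) :
    ∀ᵐ w₀ : X → A → ℝ, ∃ w, G.IsReduced φ a₀ w ∧ w 0 = w₀ ∧ IsRecurrent w := by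
  classical
  obtain ⟨C, hC⟩ := G.exists_norm_reducedField_le φ a₀
  have hξ := G.continuous_reducedField φ a₀
  have hpres := measurePreserving_fullStep hξ fun w x z =>
    G.reducedField_apply_eq_of_eq_off φ a₀ hrecall fun x' hx' => Function.update_of_ne hx' _ _
  have h := fun n : ℕ => (isScheme_fullStep hξ hC).ae_exists_recurrent hpres
    (G.isCompact_sublevel φ a₀ hκ0 hint n) fun u hu hu0 =>
      G.mem_sublevel_of_isReduced φ a₀ hmono hnash hκ hu hu0 zero_le_one
  filter_upwards [ae_all_iff.2 h] with w hw
  obtain ⟨n, hn⟩ := G.exists_mem_sublevel φ a₀ κ πs w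
  exact hw n hn

/-- The scores of a FoReL trajectory that accompanies a recurrent solution of the reduced
dynamics are recurrent up to constants, and so are the policies. -/
theorem exists_isFoReL_isRecurrent {w : ℝ → X → A → ℝ} (hw : G.IsReduced φ a₀ w)
    (hrec : IsRecurrent w) : ∃ y, G.IsFoReL φ y ∧ y 0 = w 0 ∧
      IsRecurrent (fun t => reduceScores a₀ (y t)) ∧
      IsRecurrent (fun t => G.policyOf φ (y t)) := by
  obtain ⟨y, hy, hy0, hyw⟩ := G.exists_isFoReL_of_isReduced φ a₀ hw rfl
  refine ⟨y, hy, hy0, (hrec.comp_continuous (continuous_reduceScores a₀)).congr hyw,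
    (hrec.comp_continuous (G.continuous_policyOf φ)).congr fun t ht => ?_⟩
  rw [← G.policyOf_reduceScores φ a₀, hyw t ht, policyOf_reduceScores]

/-- Uniqueness for FoReL carries over to the reduced dynamics. The starting scores at the reference
actions need not vanish; they are constants of motion. -/
theorem eqOn_of_isReduced
    (huniq : ∀ y y', G.IsFoReL φ y → G.IsFoReL φ y' → y 0 = y' 0 → ∀ t, 0 ≤ t → y t = y' t)
    {w w' : ℝ → X → A → ℝ} (hw : G.IsReduced φ a₀ w) (hw' : G.IsReduced φ a₀ w')
    (h0 : w 0 = w' 0) {t : ℝ} (ht : 0 ≤ t) : w t = w' t := by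
  obtain ⟨y, hy, hy0, hyw⟩ := G.exists_isFoReL_of_isReduced φ a₀ hw rfl
  obtain ⟨y', hy', hy0', hyw'⟩ := G.exists_isFoReL_of_isReduced φ a₀ hw' rfl
  have h1 := hyw t ht
  rw [huniq y y' hy hy' (by rw [hy0, hy0', h0]) t ht, hyw' t ht] at h1
  funext x a
  have h2 := congrFun (congrFun h1 x) a
  simp only [reduceScores] at h2
  rw [G.apply_reference_eq φ a₀ hw ht, G.apply_reference_eq φ a₀ hw' ht, h0] at h2
  linarith

theorem eq_of_isFoReL_of_strongConvexOn
    (hφ : ∀ i, ∃ m > 0, StrongConvexOn (stdSimplex ℝ A) m (φ i).toFun)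
    {y y' : ℝ → X → A → ℝ} (hy : G.IsFoReL φ y) (hy' : G.IsFoReL φ y') (h0 : y 0 = y' 0)
    {t : ℝ} (ht : 0 ≤ t) : y t = y' t := by
  have hchoice : ∀ i, ∃ K, LipschitzWith K (φ i).choice := fun i => by
    obtain ⟨m, hm, hφm⟩ := hφ i
    exact (φ i).exists_lipschitzWith_choice hm hφm
  choose K hK using hchoice
  have hpol : LipschitzWith (Finset.univ.sup K) (G.policyOf φ) := by
    refine LipschitzWith.of_dist_le_mul fun z z' => (dist_pi_le_iff (by positivity)).2 fun x => ?_
    refine ((hK (G.player x)).dist_le_mul _ _).trans ?_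
    gcongr
    · exact Finset.le_sup (f := K) (Finset.mem_univ _)
    · exact dist_le_pi_dist z z' x
  obtain ⟨L, hL⟩ := G.exists_lipschitzWith_counterfactualValue
  rw [isFoReL_iff] at hy hy'
  have hcont : ∀ {z : ℝ → X → A → ℝ},
      IsSolution (fun z => G.counterfactualValue (G.policyOf φ z)) z →
      ContinuousOn z (Set.Icc 0 t) := fun hz s hs =>
    ((hz s hs.1).mono fun _ h => h.1).continuousWithinAt
  exact ODE_solution_unique (v := fun _ z => G.counterfactualValue (G.policyOf φ z))
    (fun _ => hL.comp hpol) (hcont hy)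
    (fun s hs => (hy s hs.1).mono (Set.Ici_subset_Ici.2 hs.1)) (hcont hy')
    (fun s hs => (hy' s hs.1).mono (Set.Ici_subset_Ici.2 hs.1)) h0 ⟨ht, le_rfl⟩

/-- Recurrence forces the Lyapunov function to be constant along the solutions from almost every
starting point, so the gain, which is its rate of decrease and continuous, vanishes everywhere. -/
theorem totalGain_policyOf_eq_zero (hrecall : G.PerfectRecall) (hmono : G.IsMonotone)
    {πs : G.Policy} (hnash : G.IsNash πs) (hint : G.IsInterior πs) {κ : X → ℝ}
    (hκ0 : ∀ x, 0 < κ x)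
    (hκ : ∀ x, ∀ h ∈ G.infoSet x, G.ownReach πs (G.ownSequence (G.player x) h) = κ x)
    (w₀ : X → A → ℝ) : G.totalGain κ πs (G.policyOf φ w₀) = 0 := by
  have a₀ : X → A := fun _ => Classical.arbitrary A
  have hae : (fun w₀ => G.totalGain κ πs (G.policyOf φ w₀)) =ᵐ[volume] fun _ => 0 := by
    filter_upwards [G.ae_exists_isReduced_isRecurrent φ a₀ hrecall hmono hnash hint hκ0 hκ]
      with w₀ ⟨w, hw, hw0, hrec⟩
    have h1 := G.hasDerivWithinAt_lyapunov φ a₀ κ πs hw le_rfl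
    have h2 : HasDerivWithinAt (fun t => G.lyapunov φ κ πs (w t)) 0 (Set.Ici 0) 0 :=
      (hasDerivWithinAt_const (0 : ℝ) (Set.Ici 0) (G.lyapunov φ κ πs (w 0))).congr_of_mem
        (fun t ht => hrec.eq_of_antitoneOn (G.continuous_lyapunov φ κ πs)
          (G.antitoneOn_lyapunov φ a₀ hmono hnash hκ hw) ht) Set.self_mem_Ici
    have h3 := (uniqueDiffOn_Ici (0 : ℝ) 0 Set.self_mem_Ici).eq_deriv _ h1 h2
    rw [← hw0]
    exact neg_eq_zero.1 h3
  exact congrFun (((G.continuous_totalGain κ πs).comp (G.continuous_policyOf φ)).ae_eq_iff_eq volume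
    continuous_const |>.1 hae) w₀

/-- The Lyapunov function is conserved and positive away from the equilibrium, and it would be zero
at an accumulation point of the scores of a trajectory whose policies converge to the equilibrium. -/
theorem not_tendsto_policyOf (hrecall : G.PerfectRecall) (hmono : G.IsMonotone)
    {πs : G.Policy} (hnash : G.IsNash πs) (hint : G.IsInterior πs) {κ : X → ℝ}
    (hκ0 : ∀ x, 0 < κ x)
    (hκ : ∀ x, ∀ h ∈ G.infoSet x, G.ownReach πs (G.ownSequence (G.player x) h) = κ x)
    {y : ℝ → X → A → ℝ} (hy : G.IsFoReL φ y) (hy0 : G.policyOf φ (y 0) ≠ πs) :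
    ¬ Tendsto (fun t => G.policyOf φ (y t)) atTop (𝓝 πs) := by
  intro hlim
  have a₀ : X → A := fun _ => Classical.arbitrary A
  set w : ℝ → X → A → ℝ := fun t => reduceScores a₀ (y t)
  have hw : G.IsReduced φ a₀ w := G.isReduced_reduceScores φ a₀ hy
  have hpol : ∀ t, G.policyOf φ (w t) = G.policyOf φ (y t) := fun t =>
    G.policyOf_reduceScores φ a₀ (y t)
  have hconst : ∀ t, 0 ≤ t → G.lyapunov φ κ πs (w t) = G.lyapunov φ κ πs (w 0) := fun t ht =>
    eq_of_hasDerivWithinAt_zero (f := fun t => G.lyapunov φ κ πs (w t)) (fun s hs => by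
      have h := G.hasDerivWithinAt_lyapunov φ a₀ κ πs hw hs
      rwa [G.totalGain_policyOf_eq_zero φ hrecall hmono hnash hint hκ0 hκ, neg_zero] at h) ht
  obtain ⟨n, hn⟩ := G.exists_mem_sublevel φ a₀ κ πs (w 0)
  -- The bounded reduced scores accumulate at some `z`, which generates the equilibrium.
  obtain ⟨z, -, hz⟩ := (G.isCompact_sublevel φ a₀ hκ0 hint n).ultrafilter_le_nhds
    ((Ultrafilter.of atTop).map w) (le_principal_iff.2 (Ultrafilter.of_le atTop
      ((eventually_ge_atTop 0).mono fun t ht =>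
        G.mem_sublevel_of_isReduced φ a₀ hmono hnash hκ hw hn ht)))
  have hz : Tendsto w (Ultrafilter.of (atTop : Filter ℝ) : Filter ℝ) (𝓝 z) := hz
  have hzpol : G.policyOf φ z = πs := by
    refine tendsto_nhds_unique (((G.continuous_policyOf φ).tendsto z).comp hz) ?_
    refine (hlim.mono_left (Ultrafilter.of_le atTop)).congr fun t => (hpol t).symm
  have hzero : G.lyapunov φ κ πs z = 0 := Finset.sum_eq_zero fun x _ => by
    rw [(φ (G.player x)).coupling_eq_zero_iff.2 (congrFun hzpol x), mul_zero]
  have hw0 : G.lyapunov φ κ πs (w 0) = 0 := by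
    refine Eq.trans ?_ hzero
    refine tendsto_nhds_unique ?_ (((G.continuous_lyapunov φ κ πs).tendsto z).comp hz)
    exact tendsto_const_nhds.congr' (Ultrafilter.of_le atTop
      ((eventually_ge_atTop 0).mono fun t ht => (hconst t ht).symm))
  refine hy0 ?_
  rw [← hpol 0]
  funext x
  have h := (Finset.sum_eq_zero_iff_of_nonneg fun x _ => mul_nonneg (hκ0 x).le
    ((φ (G.player x)).coupling_nonneg (πs x) (w 0 x))).1 hw0 x (Finset.mem_univ x)
  exact (φ (G.player x)).coupling_eq_zero_iff.1 ((mul_eq_zero.1 h).resolve_left (hκ0 x).ne')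

end SeqGame

theorem mainTheorem2 {N : ℕ} {A X : Type*} [Fintype A] [Nonempty A] [Fintype X]
    (G : SeqGame N A X) (hrecall : G.PerfectRecall) (hmono : G.IsMonotone)
    (φ : Fin N → Regularizer A) (a₀ : X → A)
    (πs : G.Policy) (hnash : G.IsNash πs) (hint : G.IsInterior πs) :
    -- the reduced dynamics is divergence-free
    DivergenceFree (G.reducedField φ a₀) ∧
    -- it has solutions, and all its orbits are bounded
    (∀ w₀ : X → A → ℝ, ∃ w, G.IsReduced φ a₀ w ∧ w 0 = w₀) ∧
    (∀ w, G.IsReduced φ a₀ w → Bornology.IsBounded (w '' Set.Ici 0)) ∧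
    -- it is equivalent to FoReL and generates the same policies
    (∀ y, G.IsFoReL φ y → G.IsReduced φ a₀ (fun t => reduceScores a₀ (y t))) ∧
    (∀ y : X → A → ℝ, G.policyOf φ (reduceScores a₀ y) = G.policyOf φ y) ∧
    (∀ (w : ℝ → X → A → ℝ) (y₀ : X → A → ℝ), G.IsReduced φ a₀ w → w 0 = reduceScores a₀ y₀ →
      ∃ y, G.IsFoReL φ y ∧ y 0 = y₀ ∧ ∀ t, 0 ≤ t → reduceScores a₀ (y t) = w t) ∧
    -- Poincaré recurrence, for the reduced variables and for FoReL
    (∀ᵐ w₀ : X → A → ℝ, ∃ w, G.IsReduced φ a₀ w ∧ w 0 = w₀ ∧ IsRecurrent w) ∧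
    (∀ᵐ y₀ : X → A → ℝ, ∃ y, G.IsFoReL φ y ∧ y 0 = y₀ ∧
      IsRecurrent (fun t => reduceScores a₀ (y t)) ∧
      IsRecurrent (fun t => G.policyOf φ (y t))) ∧
    -- when FoReL trajectories are determined by their starting points, every trajectory from
    -- almost every starting point is recurrent
    ((∀ y y', G.IsFoReL φ y → G.IsFoReL φ y' → y 0 = y' 0 → ∀ t, 0 ≤ t → y t = y' t) →
      (∀ᵐ w₀ : X → A → ℝ, ∀ w, G.IsReduced φ a₀ w → w 0 = w₀ → IsRecurrent w) ∧
      (∀ᵐ y₀ : X → A → ℝ, ∀ y, G.IsFoReL φ y → y 0 = y₀ →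
        IsRecurrent (fun t => reduceScores a₀ (y t)) ∧
        IsRecurrent (fun t => G.policyOf φ (y t)))) ∧
    -- this is so for strongly convex regularizers
    ((∀ i, ∃ m > 0, StrongConvexOn (stdSimplex ℝ A) m (φ i).toFun) →
      ∀ y y', G.IsFoReL φ y → G.IsFoReL φ y' → y 0 = y' 0 → ∀ t, 0 ≤ t → y t = y' t) ∧
    -- no FoReL trajectory that does not start at the equilibrium converges to it
    (∀ y, G.IsFoReL φ y → G.policyOf φ (y 0) ≠ πs →
      ¬ Tendsto (fun t => G.policyOf φ (y t)) atTop (𝓝 πs)) := by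
  obtain ⟨κ, hκ0, hκ⟩ := G.exists_ownReach_eq hrecall hint
  have hrec := G.ae_exists_isReduced_isRecurrent φ a₀ hrecall hmono hnash hint hκ0 hκ
  refine ⟨G.divergenceFree_reducedField φ a₀ hrecall, G.exists_isReduced φ a₀,
    fun w hw => G.isBounded_of_isReduced φ a₀ hmono hnash hint hκ0 hκ hw,
    fun y hy => G.isReduced_reduceScores φ a₀ hy, G.policyOf_reduceScores φ a₀,
    fun w y₀ hw hw0 => ?_, hrec, ?_, fun huniq => ⟨?_, ?_⟩,
    fun hφ y y' hy hy' h0 t ht => G.eq_of_isFoReL_of_strongConvexOn φ hφ hy hy' h0 ht,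
    fun y hy hy0 => G.not_tendsto_policyOf φ hrecall hmono hnash hint hκ0 hκ hy hy0⟩
  · have hself : ∀ z : X → A → ℝ, (∀ x, z x (a₀ x) = 0) → reduceScores a₀ z = z := fun z hz => by
      funext x a
      rw [reduceScores, hz x, sub_zero]
    have hzero : ∀ t, 0 ≤ t → ∀ x, w t x (a₀ x) = 0 := fun t ht x => by
      rw [G.apply_reference_eq φ a₀ hw ht, hw0, reduceScores, sub_self]
    obtain ⟨y, hy, hy0, hyw⟩ := G.exists_isFoReL_of_isReduced φ a₀ hw (y₀ := y₀)
      (by rw [hself _ (hzero 0 le_rfl), hw0])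
    exact ⟨y, hy, hy0, fun t ht => by rw [hyw t ht, hself _ (hzero t ht)]⟩
  · filter_upwards [hrec] with w₀ ⟨w, hw, hw0, hwr⟩
    obtain ⟨y, hy, hy0, h1, h2⟩ := G.exists_isFoReL_isRecurrent φ a₀ hw hwr
    exact ⟨y, hy, hy0.trans hw0, h1, h2⟩
  · filter_upwards [hrec] with w₀ ⟨w, hw, hw0, hwr⟩ w' hw' hw0'
    exact hwr.congr fun t ht => G.eqOn_of_isReduced φ a₀ huniq hw' hw (hw0'.trans hw0.symm) ht
  · filter_upwards [hrec] with w₀ ⟨w, hw, hw0, hwr⟩ y' hy' hy0'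
    obtain ⟨y, hy, hy0, h1, h2⟩ := G.exists_isFoReL_isRecurrent φ a₀ hw hwr
    have heq := huniq y' y hy' hy (by rw [hy0', hy0, hw0])
    exact ⟨h1.congr fun t ht => by rw [heq t ht], h2.congr fun t ht => by rw [heq t ht]⟩
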